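/- Let $d\ge 3$ and $V>0$. Let $\sigma\in C^1([0,\infty))$ be such that $r\mapsto\sigma'(r)/r$ is negative, bounded below and monotone increasing (in the wide sense) on $(0,\infty)$ and $\int_0^\infty r^2\sigma(r)\,d(r^d)$ is finite. Put $\rho(v)=\sigma(|v+Ve_d|)$ for $v\in\mathbb R^d$ and, for $u\ge 0$ and with $z_-=\max\{-z,0\}$, $$p_\pm(u)=\pm\int_{\mathbb R^d}\frac{(v_1u\pm v_d)_-^2}{1+u^2}\,\rho(v)\,dv .$$ **The problem.** For $z\ge 0$ let $\mathcal M(z)$ be the set of convex, non-positive, non-decreasing, continuous functions $f$ on $[0,1]$ with $f(0)=-z$. For $h\ge 0$, minimize $$\mathcal R_+(f_+)+\mathcal R_-(f_-),\qquad \mathcal R_\pm(f)=\int_0^1 p_\pm(f'(t))\,d(t^{d-1}),$$ over all $f_\pm\in\mathcal M(h_\pm)$ with $h_+,h_-\ge 0$, $h_++h_-=h$. The pair $(f_+,f_-)$ describes the body $$\{(x',x_d):|x'|\le 1,\ f_-(|x'|)\le x_d\le -f_+(|x'|)\}$$ of length $h$, with front and rear parts of heights $h_+$ and $h_-$. Let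 $\mathrm R(h)$ be the minimal value. **Notation.** Let $\bar p_\pm$ be the maximal convex function on $[0,\infty)$ not exceeding $p_\pm$ (its derivative at $0$ is one-sided), and let $$B_\pm=-\bar p_\pm'(0),\quad q_\pm(u)=|\bar p_\pm'(u)|^{-1/(d-2)},\quad Q_\pm(u)=\int_0^u q_\pm(\nu)\,d\nu,\quad \mathrm h_\pm(u)=u-\frac{Q_\pm(u)}{q_\pm(u)} .$$ A *Newton profile* with parameter $U\ge0$ (with respect to $p_\pm$) is a function $f$ on $[0,1]$ such that, with $t_0=q_\pm(0)/q_\pm(U)\in(0,1]$ ($t_0<1$ if $\mathrm h_\pm(U)>0$), $f=-\mathrm h_\pm(U)$ on $[0,t_0]$, while on $[t_0,1]$ it is strictly convex and given by $$t=\frac{q_\pm(u)}{q_\pm(U)},\qquad f=-\mathrm h_\pm(U)+\frac{u\,q_\pm(u)-Q_\pm(u)}{q_\pm(U)},\qquad u\in[0,U].$$ A *Newton-type body* is a set $\{|x'|\le 1,\ 0\le x_d\le -f(|x'|)\}$ with $f$ a Newton profile. **Claim.** There is $u_*\ge 0$ with $\bar p_+'(u_*)=-B_-$, and the number $$h_*:=\mathrm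 h_+(u_*)=u_*-B_-^{1/(d-2)}Q_+(u_*)$$ is positive and the same for every such $u_*$. For every $h\ge 0$ the following holds. 1. *(First kind.)* Let $h\le h_*$. Then there is $u_+\ge 0$ with $\mathrm h_+(u_+)=h$. For every such $u_+$, the problem has exactly one solution $(f_+,f_-)$; it has $h_+=h$, $h_-=0$, $f_-\equiv 0$, and $f_+$ is the Newton profile with parameter $u_+$ with respect to $p_+$. Thus the optimal body is a Newton-type body, and $$\mathrm R(h)=\bar p_+(u_+)+\frac{Q_+(u_+)}{q_+(u_+)^{d-1}}+\bar p_-(0).$$ 2. *(Second kind.)* Let $h>h_*$. Then there is exactly one pair $(h_+,h_-)$ for which there are $u_+,u_-\ge 0$ with $$h_\pm=u_\pm-\frac{Q_\pm(u_\pm)}{q_\pm(u_\pm)},\qquad h_++h_-=h,\qquad \bar p_+'(u_+)=\bar p_-'(u_-),$$ and $h_+>0$, $h_->0$. For every solution $(h_+,h_-,u_+,u_-)$ of this system, the problem has exactly one solution $(f_+,f_-)$; it satisfies $f_\pm\in\mathcal M(h_\pm)$, and $f_\pm$ is the Newton profile with parameter $u_\pm$ with respect to $p_\pm$. Thus the optimal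 body is the union of a Newton-type body (for $p_+$) and of the mirror image under $x_d\mapsto -x_d$ of a Newton-type body (for $p_-$), glued along their flat rear parts, and $$\mathrm R(h)=\bar p_+(u_+)+\frac{Q_+(u_+)}{q_+(u_+)^{d-1}}+\bar p_-(u_-)+\frac{Q_-(u_-)}{q_-(u_-)^{d-1}} .$$ -/

import Mathlib

open Set MeasureTheory

noncomputable section

namespace ThermalDrag

/-- Index of the last coordinate of `ℝᵈ`, i.e. of the symmetry axis. -/
def axis (d : ℕ) [NeZero d] : Fin d := Fin.rev 0

/-- The class `𝒜_d` of radial densities `σ`: `C¹` on `[0, ∞)`, with `σ'(r) / r` negative,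
bounded below and monotone increasing on `(0, ∞)`, and `∫₀^∞ r² σ(r) d(r^d)` finite. -/
structure ClassA (d : ℕ) (σ : ℝ → ℝ) : Prop where
  contDiffOn : ContDiffOn ℝ 1 σ (Ici 0)
  neg : ∀ r > 0, deriv σ r / r < 0
  bddBelow : BddBelow ((fun r => deriv σ r / r) '' Ioi 0)
  mono : MonotoneOn (fun r => deriv σ r / r) (Ioi 0)
  integrable : IntegrableOn (fun r => r ^ 2 * σ r * (d * r ^ (d - 1))) (Ioi 0)

/-- The density over velocities `ρ(v) = σ(|v + V e_d|)`. -/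
def density (d : ℕ) [NeZero d] (σ : ℝ → ℝ) (V : ℝ) (v : EuclideanSpace ℝ (Fin d)) : ℝ :=
  σ ‖v + V • EuclideanSpace.single (axis d) (1 : ℝ)‖

/-- `p_ε(u) = ε ∫ (v₁ u + ε v_d)₋² / (1 + u²) ρ(v) dv`, where `z₋ = max (-z) 0`. -/
def pressure (d : ℕ) [NeZero d] (σ : ℝ → ℝ) (V ε u : ℝ) : ℝ :=
  ε * ∫ v : EuclideanSpace ℝ (Fin d),
    (max (-(v 0 * u + ε * v (axis d))) 0) ^ 2 / (1 + u ^ 2) * density d σ V v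

/-- The pressure function `p_+` of the front part of the surface. -/
def pFront (d : ℕ) [NeZero d] (σ : ℝ → ℝ) (V : ℝ) : ℝ → ℝ := pressure d σ V 1

/-- The pressure function `p_-` of the rear part of the surface. -/
def pRear (d : ℕ) [NeZero d] (σ : ℝ → ℝ) (V : ℝ) : ℝ → ℝ := pressure d σ V (-1)

/-! ### The minimization problem -/

/-- The class `𝓜(h)` of profiles: convex, non-positive, non-decreasing, continuous functions on
`[0, 1]` with `f 0 = -h`. Only the values on `[0, 1]` matter. -/
structure IsProfile (h : ℝ) (f : ℝ → ℝ) : Prop where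
  convexOn : ConvexOn ℝ (Icc 0 1) f
  nonpos : ∀ t ∈ Icc (0 : ℝ) 1, f t ≤ 0
  monotoneOn : MonotoneOn f (Icc 0 1)
  continuousOn : ContinuousOn f (Icc 0 1)
  apply_zero : f 0 = -h

/-- `𝓡(f) = ∫₀¹ p(f'(t)) d(t^{d-1})`. -/
def partResistance (d : ℕ) (p f : ℝ → ℝ) : ℝ :=
  ∫ t in (0 : ℝ)..1, p (deriv f t) * (((d : ℝ) - 1) * t ^ (d - 2))

/-- The resistance `𝓡_+(f_+) + 𝓡_-(f_-)` of the body with front profile `fp` and rear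
profile `fm`. -/
def resistance (d : ℕ) [NeZero d] (σ : ℝ → ℝ) (V : ℝ) (fp fm : ℝ → ℝ) : ℝ :=
  partResistance d (pFront d σ V) fp + partResistance d (pRear d σ V) fm

/-- Pairs of profiles of a body of length `h` along its axis: `-f_+(0) - f_-(0) = h`. -/
def Admissible (h : ℝ) (fp fm : ℝ → ℝ) : Prop :=
  ∃ hp hm : ℝ, IsProfile hp fp ∧ IsProfile hm fm ∧ hp + hm = h

/-- The values of the resistance over all bodies of length `h`. -/
def resistanceValues (d : ℕ) [NeZero d] (σ : ℝ → ℝ) (V h : ℝ) : Set ℝ :=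
  {R | ∃ fp fm : ℝ → ℝ, Admissible h fp fm ∧ R = resistance d σ V fp fm}

/-- `(fp, fm)` solves the minimal resistance problem for bodies of length `h`. -/
def IsOptimal (d : ℕ) [NeZero d] (σ : ℝ → ℝ) (V h : ℝ) (fp fm : ℝ → ℝ) : Prop :=
  Admissible h fp fm ∧
    ∀ gp gm : ℝ → ℝ, Admissible h gp gm → resistance d σ V fp fm ≤ resistance d σ V gp gm

/-- `(fp, fm)` is the unique solution (as a pair of functions on `[0, 1]`). -/
def IsUniqueOptimal (d : ℕ) [NeZero d] (σ : ℝ → ℝ) (V h : ℝ) (fp fm : ℝ → ℝ) : Prop :=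
  IsOptimal d σ V h fp fm ∧
    ∀ gp gm : ℝ → ℝ, IsOptimal d σ V h gp gm → EqOn gp fp (Icc 0 1) ∧ EqOn gm fm (Icc 0 1)

/-! ### The auxiliary functions -/

/-- `p̄`, the maximal convex function on `[0, ∞)` that does not exceed `p`. -/
def convEnv (p : ℝ → ℝ) (u : ℝ) : ℝ :=
  sSup {y | ∃ g : ℝ → ℝ, ConvexOn ℝ (Ici 0) g ∧ (∀ x ∈ Ici (0 : ℝ), g x ≤ p x) ∧ y = g u}

/-- `p̄'`, one-sided at `0`. -/
def convEnvDeriv (p : ℝ → ℝ) (u : ℝ) : ℝ := derivWithin (convEnv p) (Ici 0) u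

/-- `q(u) = |p̄'(u)|^{-1/(d-2)}`. -/
def qFun (d : ℕ) (p : ℝ → ℝ) (u : ℝ) : ℝ := |convEnvDeriv p u| ^ (-(1 / ((d : ℝ) - 2)))

/-- `Q(u) = ∫₀ᵘ q`. -/
def QFun (d : ℕ) (p : ℝ → ℝ) (u : ℝ) : ℝ := ∫ ν in (0 : ℝ)..u, qFun d p ν

/-- `h(u) = u - Q(u) / q(u)`. -/
def hFun (d : ℕ) (p : ℝ → ℝ) (u : ℝ) : ℝ := u - QFun d p u / qFun d p u

/-- `B = -p̄'(0)`. -/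
def BConst (p : ℝ → ℝ) : ℝ := -convEnvDeriv p 0

/-! ### Shapes -/

/-- The profile, with parameter `U`, of a Newton-type body of height `h(U)`: with
`t₀ = q(0) / q(U)` it is equal to `-h(U)` on `[0, t₀]`, it is given on `[t₀, 1]` by
`t = q(u) / q(U)`, `f = -h(U) + (u q(u) - Q(u)) / q(U)`, `0 ≤ u ≤ U`, and is strictly convex
there; the flat disk has positive radius, smaller than `1` if the height is positive. -/
structure IsNewtonProfile (d : ℕ) (p : ℝ → ℝ) (U : ℝ) (f : ℝ → ℝ) : Prop where
  radius_pos : 0 < qFun d p 0 / qFun d p U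
  radius_le : qFun d p 0 / qFun d p U ≤ 1
  radius_lt : 0 < hFun d p U → qFun d p 0 / qFun d p U < 1
  flat : ∀ t ∈ Icc 0 (qFun d p 0 / qFun d p U), f t = -hFun d p U
  covers : (fun u => qFun d p u / qFun d p U) '' Icc 0 U = Icc (qFun d p 0 / qFun d p U) 1
  param : ∀ u ∈ Icc 0 U,
    f (qFun d p u / qFun d p U) = -hFun d p U + (u * qFun d p u - QFun d p u) / qFun d p U
  strictConvexOn : StrictConvexOn ℝ (Icc (qFun d p 0 / qFun d p U) 1) f

/-- `|x'|`, the distance from `x = (x', x_d)` to the symmetry axis. -/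
def axisDist (d : ℕ) [NeZero d] (x : EuclideanSpace ℝ (Fin d)) : ℝ :=
  ‖x - x (axis d) • EuclideanSpace.single (axis d) (1 : ℝ)‖

/-- The body `{(x', x_d) : |x'| ≤ 1, f_-(|x'|) ≤ x_d ≤ -f_+(|x'|)}`. -/
def body (d : ℕ) [NeZero d] (fp fm : ℝ → ℝ) : Set (EuclideanSpace ℝ (Fin d)) :=
  {x | axisDist d x ≤ 1 ∧ fm (axisDist d x) ≤ x (axis d) ∧ x (axis d) ≤ -fp (axisDist d x)}

/-- The reflection `(x', x_d) ↦ (x', -x_d)`. -/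
def axisFlip (d : ℕ) [NeZero d] (x : EuclideanSpace ℝ (Fin d)) : EuclideanSpace ℝ (Fin d) :=
  x - (2 * x (axis d)) • EuclideanSpace.single (axis d) (1 : ℝ)

/-- A Newton-type body: flat rear part in the plane `x_d = 0`, Newton profile in front. -/
def IsNewtonBody (d : ℕ) [NeZero d] (p : ℝ → ℝ) (U : ℝ)
    (K : Set (EuclideanSpace ℝ (Fin d))) : Prop :=
  ∃ f : ℝ → ℝ, IsNewtonProfile d p U f ∧ K = body d f (fun _ => 0)

/-- The system for the heights `h_±` of the front and rear parts and the auxiliary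
values `u_± ≥ 0`. -/
structure SplitSystem (d : ℕ) [NeZero d] (σ : ℝ → ℝ) (V h hp hm up um : ℝ) : Prop where
  up_nonneg : 0 ≤ up
  um_nonneg : 0 ≤ um
  front : hp = up - QFun d (pFront d σ V) up / qFun d (pFront d σ V) up
  rear : hm = um - QFun d (pRear d σ V) um / qFun d (pRear d σ V) um
  total : hp + hm = h
  slopes : convEnvDeriv (pFront d σ V) up = convEnvDeriv (pRear d σ V) um

end ThermalDrag

end

open ThermalDrag

namespace ThermalDrag

open Filter Topology

/-! ### The convex envelope of a pressure function -/

/-! The length constraint is removed by a Lagrange multiplier `μ`. For a profile `g` of height `z`,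
the integral of `g'` is at most `g 1 - g 0`, hence at most `z`, so the penalized resistance of one
part is bounded below by minimizing `p w * t ^ (d - 2) + μ * w` over slopes `w ≥ 0` separately for
each `t`. A profile that ends at height `0` and whose slopes realize these minima is optimal. If the
minimizing slope is unique for almost every `t`, it is the only optimum. When both parts share one
`μ`, the penalty depends only on the total length, and the constrained problem is solved.

Such profiles come from convex duality. Minimizers of `p w + μ * w` are contact points of `p` with
its envelope `p̄`, so the Euler equation is `p̄'(u) * t ^ (d - 2) = -μ`. With `μ = -p̄'(U)` this
becomes `q(u) = t * q(U)`. Since `Q` is convex with derivative `q`, the profile with these slopes is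
a Legendre transform of `Q / q(U)`. Its height is `h(U) = max (w - Q(w) / q(U))`, which depends only
on `q(U)` and strictly increases with it.

About the pressures this uses only differentiability, boundedness and a limit strictly below all
values. These follow on writing `p_ε(u) = ε * G(ε * V / √(1 + u²))` with `G` differentiable and
strictly increasing. The even part of `G` is an explicit quadratic, so `p_+ - p_-` is a constant
plus a positive multiple of `1 / (1 + u²)`, which gives `p̄_+'(0) < p̄_-'(0)`. A flat rear part
therefore remains optimal as long as `μ ≥ B_-`, that is for lengths up to `h_* > 0`. Beyond that
both parts grow, with the common multiplier fixed by the length. -/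

/-- The properties of a pressure function used for the variational problem. -/
structure IsPressure (p : ℝ → ℝ) : Prop where
  differentiable : Differentiable ℝ p
  bounded : ∃ M, ∀ u, |p u| ≤ M
  limit : ∃ L, (∀ u, 0 ≤ u → L < p u) ∧ Tendsto p atTop (𝓝 L)

namespace IsPressure

variable {p : ℝ → ℝ}

theorem convEnv_le (hp : IsPressure p) {u : ℝ} (hu : 0 ≤ u) : convEnv p u ≤ p u := by
  obtain ⟨M, hM⟩ := hp.bounded
  refine csSup_le ⟨-M, fun _ => -M, convexOn_const _ (convex_Ici 0),
    fun x _ => (abs_le.1 (hM x)).1, rfl⟩ ?_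
  rintro y ⟨g, -, hg, rfl⟩
  exact hg u hu

theorem le_convEnv {g : ℝ → ℝ} (hg : ConvexOn ℝ (Ici 0) g)
    (hle : ∀ x ∈ Ici (0 : ℝ), g x ≤ p x) {u : ℝ} (hu : 0 ≤ u) : g u ≤ convEnv p u := by
  refine le_csSup ⟨p u, ?_⟩ ⟨g, hg, hle, rfl⟩
  rintro y ⟨g, -, hg, rfl⟩
  exact hg u hu

theorem convexOn_affine (c s : ℝ) (S : Set ℝ) (hS : Convex ℝ S) :
    ConvexOn ℝ S (fun w => c + s * w) := by
  refine ⟨hS, fun x _ y _ a b _ _ hab => le_of_eq ?_⟩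
  simp only [smul_eq_mul]
  linear_combination (-c) * hab

theorem affine_le_convEnv {c s : ℝ} (h : ∀ w, 0 ≤ w → c + s * w ≤ p w) {u : ℝ} (hu : 0 ≤ u) :
    c + s * u ≤ convEnv p u :=
  le_convEnv (convexOn_affine c s _ (convex_Ici 0)) h hu

theorem convexOn_convEnv (hp : IsPressure p) : ConvexOn ℝ (Ici 0) (convEnv p) := by
  obtain ⟨M, hM⟩ := hp.bounded
  refine ⟨convex_Ici 0, fun x hx y hy a b ha hb hab => ?_⟩
  refine csSup_le ⟨-M, fun _ => -M, convexOn_const _ (convex_Ici 0),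
    fun x _ => (abs_le.1 (hM x)).1, rfl⟩ ?_
  rintro z ⟨g, hg, hgp, rfl⟩
  refine (hg.2 hx hy ha hb hab).trans ?_
  simp only [smul_eq_mul]
  exact add_le_add (mul_le_mul_of_nonneg_left (le_convEnv hg hgp hx) ha)
    (mul_le_mul_of_nonneg_left (le_convEnv hg hgp hy) hb)

/-- Beyond `2 * M / μ` the linear term exceeds the oscillation of `p`, so the search is confined to
a compact interval. -/
theorem exists_min (hp : IsPressure p) {μ : ℝ} (hμ : 0 < μ) :
    ∃ w₀, 0 ≤ w₀ ∧ ∀ w, 0 ≤ w → p w₀ + μ * w₀ ≤ p w + μ * w := by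
  obtain ⟨M, hM⟩ := hp.bounded
  have hM0 : 0 ≤ M := (abs_nonneg _).trans (hM 0)
  have hR : 0 ≤ 2 * M / μ := by positivity
  obtain ⟨w₀, hw₀, hmin⟩ := isCompact_Icc.exists_isMinOn (nonempty_Icc.2 hR)
    (f := fun w => p w + μ * w)
    (hp.differentiable.continuous.add (continuous_const.mul continuous_id)).continuousOn
  refine ⟨w₀, hw₀.1, fun w hw => ?_⟩
  by_cases hwR : w ≤ 2 * M / μ
  · exact hmin ⟨hw, hwR⟩
  · have h0 : p w₀ + μ * w₀ ≤ p 0 + μ * 0 := hmin ⟨le_rfl, hR⟩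
    have h1 : 2 * M < μ * w := by
      rw [not_le, div_lt_iff₀ hμ] at hwR
      linarith
    linarith [(abs_le.1 (hM w)).1, (abs_le.1 (hM 0)).2]

/-- A minimizer of `p w + μ w` is a contact point of `p` with its convex envelope, and it
minimizes `p̄ w + μ w`. -/
theorem exists_min_convEnv (hp : IsPressure p) {μ : ℝ} (hμ : 0 < μ) :
    ∃ w₀, 0 ≤ w₀ ∧ convEnv p w₀ = p w₀ ∧
      ∀ w, 0 ≤ w → convEnv p w₀ + μ * w₀ ≤ convEnv p w + μ * w := by
  obtain ⟨w₀, hw₀, hmin⟩ := hp.exists_min hμ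
  have key : ∀ w, 0 ≤ w → p w₀ + μ * w₀ + (-μ) * w ≤ convEnv p w := fun w hw =>
    affine_le_convEnv (fun v hv => by linarith [hmin v hv]) hw
  have heq : convEnv p w₀ = p w₀ :=
    le_antisymm (hp.convEnv_le hw₀) (by linarith [key w₀ hw₀])
  exact ⟨w₀, hw₀, heq, fun w hw => by rw [heq]; linarith [key w hw]⟩

/-- Differentiability controls `p` near `0` and boundedness does so elsewhere. The line obtained
makes the envelope agree with `p` at `0` and keeps its initial slope finite. -/
theorem exists_linear_lower (hp : IsPressure p) : ∃ C, ∀ u, 0 ≤ u → p 0 - C * u ≤ p u := by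
  obtain ⟨M, hM⟩ := hp.bounded
  have hM0 : 0 ≤ M := (abs_nonneg _).trans (hM 0)
  have hd := (hasDerivAt_iff_isLittleO.1 (hp.differentiable 0).hasDerivAt).def one_pos
  obtain ⟨δ, hδ, hball⟩ := Metric.eventually_nhds_iff.1 hd
  refine ⟨|deriv p 0| + 1 + 2 * M / δ, fun u hu => ?_⟩
  have h1 : 0 ≤ |deriv p 0| * u := by positivity
  have h2 : 0 ≤ 2 * M / δ * u := by positivity
  by_cases hu' : u < δ
  · have := hball (y := u) (by rw [Real.dist_eq, sub_zero, abs_of_nonneg hu]; exact hu')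
    simp only [sub_zero, smul_eq_mul, one_mul, Real.norm_eq_abs, abs_of_nonneg hu] at this
    have h3 := (abs_le.1 this).1
    have h4 : -(|deriv p 0|) * u ≤ deriv p 0 * u :=
      mul_le_mul_of_nonneg_right (neg_abs_le _) hu
    linarith
  · have h3 : 2 * M ≤ 2 * M / δ * u := by
      rw [div_mul_eq_mul_div, le_div_iff₀ hδ]
      exact mul_le_mul_of_nonneg_left (not_lt.1 hu') (by positivity)
    linarith [(abs_le.1 (hM u)).1, (abs_le.1 (hM 0)).2]

theorem convEnv_zero (hp : IsPressure p) : convEnv p 0 = p 0 := by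
  obtain ⟨C, hC⟩ := hp.exists_linear_lower
  refine le_antisymm (hp.convEnv_le le_rfl) ?_
  have := affine_le_convEnv (p := p) (c := p 0) (s := -C)
    (fun w hw => by linarith [hC w hw]) (le_refl 0)
  linarith

/-- The maximum of `L` and a line descending from the minimum of `p` on `[0, u + 1]` to the value
`L` at `u + 1` is a convex minorant of `p`, strictly above `L` at `u`. -/
theorem exists_lt_convEnv (hp : IsPressure p) :
    ∃ L, (∀ u, 0 ≤ u → L < convEnv p u) ∧ Tendsto p atTop (𝓝 L) := by
  obtain ⟨L, hL, hlim⟩ := hp.limit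
  refine ⟨L, fun u hu => ?_, hlim⟩
  have hu1 : (0 : ℝ) < u + 1 := by linarith
  obtain ⟨w, hw, hmin⟩ := isCompact_Icc.exists_isMinOn (nonempty_Icc.2 hu1.le)
    hp.differentiable.continuous.continuousOn
  have hδ : 0 < p w - L := sub_pos.2 (hL w hw.1)
  have hconv : ConvexOn ℝ (Ici 0)
      ((fun _ => L) ⊔ fun v => p w + (-((p w - L) / (u + 1))) * v) :=
    (convexOn_const L (convex_Ici 0)).sup (convexOn_affine _ _ _ (convex_Ici 0))
  have h := le_convEnv (p := p) hconv (fun v hv => by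
    refine sup_le (hL v hv).le ?_
    have hv0 : (0 : ℝ) ≤ v := hv
    by_cases hvu : v ≤ u + 1
    · have h1 : p w ≤ p v := hmin ⟨hv, hvu⟩
      have : 0 ≤ (p w - L) / (u + 1) * v := by positivity
      linarith
    · have h1 : p w - L ≤ (p w - L) / (u + 1) * v := by
        rw [div_mul_eq_mul_div, le_div_iff₀ hu1]
        exact mul_le_mul_of_nonneg_left (not_le.1 hvu).le hδ.le
      linarith [hL v hv]) hu
  refine lt_of_lt_of_le ?_ (le_sup_right.trans h)
  have h1 : (p w - L) / (u + 1) * u < p w - L := by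
    rw [div_mul_eq_mul_div, div_lt_iff₀ hu1]
    exact mul_lt_mul_of_pos_left (by linarith) hδ
  linarith

theorem subgradient_nonpos (hp : IsPressure p) {u b : ℝ}
    (hb : ∀ w, u < w → convEnv p u + b * (w - u) ≤ convEnv p w) (hu : 0 ≤ u) : b ≤ 0 := by
  obtain ⟨M, hM⟩ := hp.bounded
  by_contra! hb0
  have hK : convEnv p u ≤ M := (hp.convEnv_le hu).trans (abs_le.1 (hM u)).2
  have hpos : 0 < (M - convEnv p u) / b + 1 := by
    have : 0 ≤ (M - convEnv p u) / b := div_nonneg (by linarith) hb0.le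
    linarith
  have h1 := hb (u + ((M - convEnv p u) / b + 1)) (by linarith)
  have h2 : convEnv p (u + ((M - convEnv p u) / b + 1)) ≤ M :=
    (hp.convEnv_le (by linarith)).trans (abs_le.1 (hM _)).2
  have h3 : b * (u + ((M - convEnv p u) / b + 1) - u) = M - convEnv p u + b := by
    field_simp
    ring
  linarith

/-- At a kink of the envelope, every slope strictly between the one-sided derivatives would equal
the derivative of `p` there, which is impossible for two different slopes. -/
theorem differentiableAt_convEnv (hp : IsPressure p) {u : ℝ} (hu : 0 < u) :
    DifferentiableAt ℝ (convEnv p) u := by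
  have hc := hp.convexOn_convEnv
  have hi : u ∈ interior (Ici (0 : ℝ)) := by rwa [interior_Ici]
  set a := derivWithin (convEnv p) (Iio u) u with ha
  set b := derivWithin (convEnv p) (Ioi u) u with hb
  have hL := hc.hasDerivWithinAt_leftDeriv_of_mem_interior hi
  have hR := hc.hasDerivWithinAt_rightDeriv_of_mem_interior hi
  have hab : a ≤ b := hc.leftDeriv_le_rightDeriv_of_mem_interior hi
  have hright : ∀ w, u < w → convEnv p u + b * (w - u) ≤ convEnv p w := fun w hw => by
    have := hc.rightDeriv_le_slope_of_mem_interior hi (hu.le.trans hw.le : (0:ℝ) ≤ w) hw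
    rw [slope_def_field, le_div_iff₀ (sub_pos.2 hw)] at this
    linarith
  have hleft : ∀ w, 0 ≤ w → w < u → convEnv p u + a * (w - u) ≤ convEnv p w := fun w hw hwu => by
    have := hc.slope_le_leftDeriv_of_mem_interior (show w ∈ Ici (0:ℝ) from hw) hi hwu
    rw [slope_def_field, div_le_iff₀ (sub_pos.2 hwu)] at this
    linarith
  have hb0 : b ≤ 0 := hp.subgradient_nonpos hright hu.le
  have key : ∀ s, a < s → s < b → deriv p u = s := by
    intro s has hsb
    obtain ⟨w₀, hw₀, heq, hmin⟩ := hp.exists_min_convEnv (μ := -s) (by linarith)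
    -- For a slope strictly inside the kink, the tilted envelope has its only minimum at `u`. Hence
    -- the contact point produced by minimizing `p` is `u` itself.
    have hwu : w₀ = u := by
      have h0 := hmin u hu.le
      rcases lt_trichotomy w₀ u with h | h | h
      · nlinarith [hleft w₀ hw₀ h]
      · exact h
      · nlinarith [hright w₀ h]
    subst hwu
    have hloc : IsLocalMin (fun w => p w - s * w) w₀ := by
      filter_upwards [lt_mem_nhds hu] with w hw
      have h1 := hmin w hw.le
      have h2 := hp.convEnv_le hw.le
      rw [heq] at h1
      linarith
    have hd : HasDerivAt (fun w => p w - s * w) (deriv p w₀ - s * 1) w₀ :=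
      (hp.differentiable w₀).hasDerivAt.sub ((hasDerivAt_id w₀).const_mul s)
    linarith [hloc.hasDerivAt_eq_zero hd]
  have heq : a = b := by
    by_contra hne
    have hlt := lt_of_le_of_ne hab hne
    have h1 := key ((2 * a + b) / 3) (by linarith) (by linarith)
    have h2 := key ((a + 2 * b) / 3) (by linarith) (by linarith)
    linarith
  rw [← ha, heq] at hL
  have hLR := (hasDerivWithinAt_Iio_iff_Iic.1 hL).union (hasDerivWithinAt_Ioi_iff_Ici.1 hR)
  rw [Iic_union_Ici, hasDerivWithinAt_univ] at hLR
  exact hLR.differentiableAt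

theorem differentiableOn_convEnv (hp : IsPressure p) :
    DifferentiableOn ℝ (convEnv p) (Ici 0) := by
  intro u hu
  rcases eq_or_lt_of_le (show (0 : ℝ) ≤ u from hu) with rfl | hu0
  · obtain ⟨C, hC⟩ := hp.exists_linear_lower
    -- Slopes from `0` are monotone by convexity and bounded below by the linear minorant, so they
    -- converge to their infimum.
    have hmono : MonotoneOn (slope (convEnv p) 0) (Ioo 0 1) :=
      (hp.convexOn_convEnv.slope_mono (mem_Ici.2 le_rfl)).mono fun w hw =>
        ⟨hw.1.le, hw.1.ne'⟩
    have hbdd : BddBelow (slope (convEnv p) 0 '' Ioo 0 1) := by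
      refine ⟨-C, ?_⟩
      rintro _ ⟨w, hw, rfl⟩
      rw [slope_def_field, le_div_iff₀ (by linarith [hw.1]), hp.convEnv_zero]
      have := affine_le_convEnv (p := p) (c := p 0) (s := -C)
        (fun w hw => by linarith [hC w hw]) hw.1.le
      linarith
    have ht := hmono.tendsto_nhdsWithin_Ioo_right (by simp) hbdd
    have hd : HasDerivWithinAt (convEnv p) (sInf (slope (convEnv p) 0 '' Ioo 0 1)) (Ioi 0) 0 := by
      rw [hasDerivWithinAt_iff_tendsto_slope]
      simpa using ht
    exact (hasDerivWithinAt_Ioi_iff_Ici.1 hd).differentiableWithinAt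
  · exact (hp.differentiableAt_convEnv hu0).differentiableWithinAt

theorem hasDerivWithinAt_convEnv (hp : IsPressure p) {u : ℝ} (hu : 0 ≤ u) :
    HasDerivWithinAt (convEnv p) (convEnvDeriv p u) (Ici 0) u :=
  (hp.differentiableOn_convEnv u hu).hasDerivWithinAt

theorem monotoneOn_convEnvDeriv (hp : IsPressure p) : MonotoneOn (convEnvDeriv p) (Ici 0) :=
  hp.convexOn_convEnv.monotoneOn_derivWithin hp.differentiableOn_convEnv

/-- The supporting line of the convex envelope. -/
theorem support_le_convEnv (hp : IsPressure p) {u w : ℝ} (hu : 0 ≤ u) (hw : 0 ≤ w) :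
    convEnv p u + convEnvDeriv p u * (w - u) ≤ convEnv p w := by
  rcases lt_trichotomy u w with h | rfl | h
  · have := hp.convexOn_convEnv.le_slope_of_hasDerivWithinAt hu hw h
      (hp.hasDerivWithinAt_convEnv hu)
    rw [slope_def_field, le_div_iff₀ (sub_pos.2 h)] at this
    linarith
  · simp
  · have := hp.convexOn_convEnv.slope_le_of_hasDerivWithinAt hw hu h
      (hp.hasDerivWithinAt_convEnv hu)
    rw [slope_def_field, div_le_iff₀ (sub_pos.2 h)] at this
    linarith

/-- A nonnegative slope at `u` would keep `p` above `convEnv p u > L` from `u` on, contrary to the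
limit `L`. -/
theorem convEnvDeriv_neg (hp : IsPressure p) {u : ℝ} (hu : 0 ≤ u) : convEnvDeriv p u < 0 := by
  obtain ⟨L, hL, hlim⟩ := hp.exists_lt_convEnv
  by_contra! h
  refine absurd (hL u hu) (not_lt.2 ?_)
  refine ge_of_tendsto hlim ?_
  filter_upwards [eventually_ge_atTop u] with w hw
  have h1 := hp.support_le_convEnv hu (hu.trans hw)
  have h2 := hp.convEnv_le (hu.trans hw)
  have h3 : 0 ≤ convEnvDeriv p u * (w - u) := mul_nonneg h (by linarith)
  linarith

/-- First-order condition on a half-line. The inequality at the endpoint `0` is what produces the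
flat disk of the profile. -/
theorem deriv_of_min_convEnv (hp : IsPressure p) {u μ : ℝ} (hu : 0 ≤ u)
    (hmin : ∀ w, 0 ≤ w → convEnv p u + μ * u ≤ convEnv p w + μ * w) :
    convEnvDeriv p u = -μ ∨ u = 0 ∧ -μ ≤ convEnvDeriv p 0 := by
  rcases eq_or_lt_of_le hu with rfl | hu0
  · right
    refine ⟨rfl, ?_⟩
    have h := hasDerivWithinAt_iff_tendsto_slope.1 (hp.hasDerivWithinAt_convEnv le_rfl)
    rw [Ici_sdiff_left] at h
    refine ge_of_tendsto h ?_
    filter_upwards [self_mem_nhdsWithin] with w hw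
    have hw' : (0 : ℝ) < w := hw
    rw [slope_def_field, le_div_iff₀ (by linarith)]
    linarith [hmin w hw'.le]
  · left
    have hloc : IsLocalMin (fun w => convEnv p w + μ * w) u := by
      filter_upwards [lt_mem_nhds hu0] with w hw using hmin w hw.le
    have hd : HasDerivAt (fun w => convEnv p w + μ * w) (convEnvDeriv p u + μ * 1) u :=
      ((hp.hasDerivWithinAt_convEnv hu).hasDerivAt (Ici_mem_nhds hu0)).add
        ((hasDerivAt_id u).const_mul μ)
    linarith [hloc.hasDerivAt_eq_zero hd]

theorem exists_convEnvDeriv_eq (hp : IsPressure p) {μ : ℝ} (hμ : 0 < μ)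
    (h0 : convEnvDeriv p 0 ≤ -μ) : ∃ u, 0 ≤ u ∧ convEnvDeriv p u = -μ := by
  obtain ⟨w, hw, -, hmin⟩ := hp.exists_min_convEnv hμ
  refine ⟨w, hw, ?_⟩
  rcases hp.deriv_of_min_convEnv hw hmin with h | ⟨rfl, h⟩
  · exact h
  · exact le_antisymm h0 h

/-- A derivative has the Darboux property, and a monotone function with order-connected image has no
jumps. -/
theorem continuousOn_convEnvDeriv (hp : IsPressure p) :
    ContinuousOn (convEnvDeriv p) (Ici 0) := by
  have hm := hp.monotoneOn_convEnvDeriv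
  have hoc : OrdConnected (convEnvDeriv p '' Ici 0) :=
    ordConnected_Ici.image_hasDerivWithinAt fun x hx => hp.hasDerivWithinAt_convEnv hx
  intro x hx
  refine tendsto_order.2 ⟨fun b hb => ?_, fun b hb => ?_⟩
  · by_cases hz : ∃ z ∈ Ici (0 : ℝ), convEnvDeriv p z ≤ b
    · obtain ⟨z, hz, hzb⟩ := hz
      obtain ⟨c, hbc, hcx⟩ := exists_between hb
      obtain ⟨y, hy, rfl⟩ := hoc.out ⟨z, hz, rfl⟩ ⟨x, hx, rfl⟩ ⟨hzb.trans hbc.le, hcx.le⟩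
      have hyx : y < x := lt_of_not_ge fun h => (hm hx hy h).not_gt hcx
      filter_upwards [self_mem_nhdsWithin, nhdsWithin_le_nhds (lt_mem_nhds hyx)] with w hw hyw
      exact hbc.trans_le (hm hy hw hyw.le)
    · push Not at hz
      filter_upwards [self_mem_nhdsWithin] with w hw using hz w hw
  · by_cases hz : ∃ z ∈ Ici (0 : ℝ), b ≤ convEnvDeriv p z
    · obtain ⟨z, hz, hzb⟩ := hz
      obtain ⟨c, hxc, hcb⟩ := exists_between hb
      obtain ⟨y, hy, rfl⟩ := hoc.out ⟨x, hx, rfl⟩ ⟨z, hz, rfl⟩ ⟨hxc.le, hcb.le.trans hzb⟩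
      have hyx : x < y := lt_of_not_ge fun h => (hm hy hx h).not_gt hxc
      filter_upwards [self_mem_nhdsWithin, nhdsWithin_le_nhds (gt_mem_nhds hyx)] with w hw hyw
      exact (hm hw hy hyw.le).trans_lt hcb
    · push Not at hz
      filter_upwards [self_mem_nhdsWithin] with w hw using hz w hw

end IsPressure

namespace IsPressure

variable {p p' : ℝ → ℝ} {d : ℕ}

/-! ### The auxiliary functions `q`, `Q` and `h` -/

theorem sub_two_pos (hd : 3 ≤ d) : (0 : ℝ) < (d : ℝ) - 2 := by
  have : (3 : ℝ) ≤ d := by exact_mod_cast hd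
  linarith

theorem qFun_eq (hp : IsPressure p) {u : ℝ} (hu : 0 ≤ u) :
    qFun d p u = (-convEnvDeriv p u) ^ (-(1 / ((d : ℝ) - 2))) := by
  rw [qFun, abs_of_neg (hp.convEnvDeriv_neg hu)]

theorem qFun_pos (hp : IsPressure p) {u : ℝ} (hu : 0 ≤ u) : 0 < qFun d p u := by
  rw [hp.qFun_eq hu]
  exact Real.rpow_pos_of_pos (neg_pos.2 (hp.convEnvDeriv_neg hu)) _

/-- This is the definition of `q` with a natural exponent, the form in which the Euler equation
meets the weight `t ^ (d - 2)`. -/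
theorem neg_convEnvDeriv_mul_qFun_pow (hp : IsPressure p) (hd : 3 ≤ d) {u : ℝ} (hu : 0 ≤ u) :
    -convEnvDeriv p u * qFun d p u ^ (d - 2) = 1 := by
  have hm : 0 < -convEnvDeriv p u := neg_pos.2 (hp.convEnvDeriv_neg hu)
  have h2 := (sub_two_pos hd).ne'
  rw [hp.qFun_eq hu, ← Real.rpow_natCast, ← Real.rpow_mul hm.le,
    Nat.cast_sub (by omega : 2 ≤ d)]
  have : -(1 / ((d : ℝ) - 2)) * ((d : ℝ) - (2 : ℕ)) = -1 := by
    push_cast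
    field_simp
  rw [this, Real.rpow_neg_one, mul_inv_cancel₀ hm.ne']

/-- Two different pressures are allowed, because the front and rear parts are coupled through
equality of slopes. -/
theorem qFun_lt_qFun (hp : IsPressure p) (hp' : IsPressure p') (hd : 3 ≤ d) {u w : ℝ}
    (hu : 0 ≤ u) (hw : 0 ≤ w) :
    qFun d p u < qFun d p' w ↔ convEnvDeriv p u < convEnvDeriv p' w := by
  have h2 : -(1 / ((d : ℝ) - 2)) < 0 := neg_lt_zero.2 (one_div_pos.2 (sub_two_pos hd))
  rw [hp.qFun_eq hu, hp'.qFun_eq hw, Real.rpow_lt_rpow_iff_of_neg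
    (neg_pos.2 (hp.convEnvDeriv_neg hu)) (neg_pos.2 (hp'.convEnvDeriv_neg hw)) h2, neg_lt_neg_iff]

theorem qFun_le_qFun (hp : IsPressure p) (hp' : IsPressure p') (hd : 3 ≤ d) {u w : ℝ}
    (hu : 0 ≤ u) (hw : 0 ≤ w) :
    qFun d p u ≤ qFun d p' w ↔ convEnvDeriv p u ≤ convEnvDeriv p' w := by
  rw [← not_lt, ← not_lt, qFun_lt_qFun hp' hp hd hw hu]

theorem qFun_eq_qFun (hp : IsPressure p) (hp' : IsPressure p') (hd : 3 ≤ d) {u w : ℝ}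
    (hu : 0 ≤ u) (hw : 0 ≤ w) :
    qFun d p u = qFun d p' w ↔ convEnvDeriv p u = convEnvDeriv p' w := by
  rw [le_antisymm_iff, le_antisymm_iff, qFun_le_qFun hp hp' hd hu hw,
    qFun_le_qFun hp' hp hd hw hu]

theorem monotoneOn_qFun (hp : IsPressure p) (hd : 3 ≤ d) : MonotoneOn (qFun d p) (Ici 0) :=
  fun _ hu _ hw huw => (qFun_le_qFun hp hp hd hu hw).2 (hp.monotoneOn_convEnvDeriv hu hw huw)

theorem continuousOn_qFun (hp : IsPressure p) : ContinuousOn (qFun d p) (Ici 0) :=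
  (hp.continuousOn_convEnvDeriv.abs).rpow_const fun _ hu =>
    Or.inl (abs_pos.2 (hp.convEnvDeriv_neg hu).ne).ne'

theorem exists_qFun_eq (hp : IsPressure p) (hd : 3 ≤ d) {y : ℝ} (hy : qFun d p 0 ≤ y) :
    ∃ u, 0 ≤ u ∧ qFun d p u = y := by
  have hy0 : 0 < y := (hp.qFun_pos le_rfl).trans_le hy
  have h2 := (sub_two_pos hd).ne'
  have hinv : (y ^ (-((d : ℝ) - 2))) ^ (-(1 / ((d : ℝ) - 2))) = y := by
    rw [← Real.rpow_mul hy0.le]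
    have : -((d : ℝ) - 2) * -(1 / ((d : ℝ) - 2)) = 1 := by field_simp
    rw [this, Real.rpow_one]
  have hμ : 0 < y ^ (-((d : ℝ) - 2)) := Real.rpow_pos_of_pos hy0 _
  have hlt : -(1 / ((d : ℝ) - 2)) < 0 := neg_lt_zero.2 (one_div_pos.2 (sub_two_pos hd))
  obtain ⟨u, hu, hu'⟩ := hp.exists_convEnvDeriv_eq hμ (by
    rw [hp.qFun_eq le_rfl, ← hinv, Real.rpow_le_rpow_iff_of_neg
      (neg_pos.2 (hp.convEnvDeriv_neg le_rfl)) hμ hlt] at hy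
    linarith)
  exact ⟨u, hu, by rw [hp.qFun_eq hu, hu', neg_neg, hinv]⟩

theorem intervalIntegrable_qFun (hp : IsPressure p) {a b : ℝ} (ha : 0 ≤ a) (hb : 0 ≤ b) :
    IntervalIntegrable (qFun d p) volume a b :=
  (hp.continuousOn_qFun.mono fun _ hx => (le_inf ha hb).trans hx.1).intervalIntegrable

theorem QFun_sub_QFun (hp : IsPressure p) {a b : ℝ} (ha : 0 ≤ a) (hb : 0 ≤ b) :
    QFun d p b - QFun d p a = ∫ ν in a..b, qFun d p ν :=
  intervalIntegral.integral_interval_sub_left (hp.intervalIntegrable_qFun le_rfl hb)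
    (hp.intervalIntegrable_qFun le_rfl ha)

/-- `Q` is convex with derivative `q`. -/
theorem QFun_support (hp : IsPressure p) (hd : 3 ≤ d) {u w : ℝ} (hu : 0 ≤ u) (hw : 0 ≤ w) :
    QFun d p u + qFun d p u * (w - u) ≤ QFun d p w := by
  have hm := hp.monotoneOn_qFun hd
  rcases le_total u w with h | h
  · have h1 : ∫ _ν in u..w, qFun d p u ≤ ∫ ν in u..w, qFun d p ν :=
      intervalIntegral.integral_mono_on h intervalIntegrable_const
        (hp.intervalIntegrable_qFun hu hw) fun x hx => hm hu (hu.trans hx.1) hx.1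
    rw [intervalIntegral.integral_const, smul_eq_mul, ← hp.QFun_sub_QFun hu hw] at h1
    linarith
  · have h1 : ∫ ν in w..u, qFun d p ν ≤ ∫ _ν in w..u, qFun d p u :=
      intervalIntegral.integral_mono_on h (hp.intervalIntegrable_qFun hw hu)
        intervalIntegrable_const fun x hx => hm (hw.trans hx.1) hu hx.2
    rw [intervalIntegral.integral_const, smul_eq_mul, ← hp.QFun_sub_QFun hw hu] at h1
    linarith

theorem QFun_support_strict (hp : IsPressure p) (hd : 3 ≤ d) {u w : ℝ} (hu : 0 ≤ u)
    (hw : 0 ≤ w) (hne : qFun d p u ≠ qFun d p w) :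
    QFun d p u + qFun d p u * (w - u) < QFun d p w := by
  have hm := hp.monotoneOn_qFun hd
  -- Chaining the support inequalities at `u` and at an intermediate `c` gains exactly `(q(c) -
  -- q(u)) * (w - c)`.
  obtain ⟨c, hc0, hc⟩ : ∃ c, 0 ≤ c ∧ 0 < (qFun d p c - qFun d p u) * (w - c) := by
    rcases lt_or_gt_of_ne hne with h | h
    · obtain ⟨y, hy1, hy2⟩ := exists_between h
      obtain ⟨c, hc, rfl⟩ := hp.exists_qFun_eq hd ((hm (mem_Ici.2 le_rfl) hu hu).trans hy1.le)
      have hcw : c < w := lt_of_not_ge fun h' => (hm hw hc h').not_gt hy2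
      exact ⟨c, hc, mul_pos (by linarith) (by linarith)⟩
    · obtain ⟨y, hy1, hy2⟩ := exists_between h
      obtain ⟨c, hc, rfl⟩ := hp.exists_qFun_eq hd ((hm (mem_Ici.2 le_rfl) hw hw).trans hy1.le)
      have hcw : w < c := lt_of_not_ge fun h' => (hm hc hw h').not_gt hy1
      exact ⟨c, hc, mul_pos_of_neg_of_neg (by linarith) (by linarith)⟩
  have h1 := hp.QFun_support hd hu hc0
  have h2 := hp.QFun_support hd hc0 hw
  nlinarith

theorem QFun_zero : QFun d p 0 = 0 := by simp [QFun]

theorem QFun_nonneg (hp : IsPressure p) {u : ℝ} (hu : 0 ≤ u) : 0 ≤ QFun d p u :=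
  intervalIntegral.integral_nonneg hu fun _ hx => (hp.qFun_pos hx.1).le

theorem QFun_pos (hp : IsPressure p) (hd : 3 ≤ d) {u : ℝ} (hu : 0 < u) : 0 < QFun d p u := by
  have h := hp.QFun_support hd le_rfl hu.le
  rw [QFun_zero] at h
  have := mul_pos (hp.qFun_pos (d := d) le_rfl) hu
  linarith

theorem continuousOn_QFun (hp : IsPressure p) : ContinuousOn (QFun d p) (Ici 0) := by
  intro u hu
  have hu0 : (0 : ℝ) ≤ u := hu
  have h := intervalIntegral.continuousOn_primitive_interval' (b₁ := 0) (b₂ := u + 1)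
    (hp.intervalIntegrable_qFun (d := d) le_rfl (by linarith)) left_mem_uIcc u
    (by rw [uIcc_of_le (by linarith)]; exact ⟨hu, by linarith⟩)
  refine h.mono_of_mem_nhdsWithin ?_
  rw [uIcc_of_le (by linarith)]
  filter_upwards [self_mem_nhdsWithin, nhdsWithin_le_nhds (gt_mem_nhds (lt_add_one u))]
    with x hx hx'
  exact ⟨hx, hx'.le⟩

theorem continuousOn_hFun (hp : IsPressure p) : ContinuousOn (hFun d p) (Ici 0) :=
  continuousOn_id.sub (hp.continuousOn_QFun.div hp.continuousOn_qFun
    fun _ hu => (hp.qFun_pos hu).ne')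

theorem hFun_zero : hFun d p 0 = 0 := by simp [hFun, QFun_zero]

/-- `h(u)` is the maximum of `w - Q(w) / q(u)` over `w ≥ 0`. -/
theorem sub_QFun_div_le_hFun (hp : IsPressure p) (hd : 3 ≤ d) {u w : ℝ} (hu : 0 ≤ u)
    (hw : 0 ≤ w) : w - QFun d p w / qFun d p u ≤ hFun d p u := by
  have hq := hp.qFun_pos (d := d) hu
  have h : (QFun d p u + qFun d p u * (w - u)) / qFun d p u ≤ QFun d p w / qFun d p u :=
    div_le_div_of_nonneg_right (hp.QFun_support hd hu hw) hq.le
  rw [add_div, mul_div_cancel_left₀ _ hq.ne'] at h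
  rw [hFun]
  linarith

theorem hFun_nonneg (hp : IsPressure p) (hd : 3 ≤ d) {u : ℝ} (hu : 0 ≤ u) :
    0 ≤ hFun d p u := by
  simpa [QFun_zero] using hp.sub_QFun_div_le_hFun hd hu le_rfl

/-- The maximum formula for `h` involves `u` only through `q(u)`. This matters because `q` may be
constant on intervals. -/
theorem hFun_congr (hp : IsPressure p) (hd : 3 ≤ d) {u w : ℝ} (hu : 0 ≤ u) (hw : 0 ≤ w)
    (h : qFun d p u = qFun d p w) : hFun d p u = hFun d p w := by
  refine le_antisymm ?_ ?_
  · have := hp.sub_QFun_div_le_hFun hd hw hu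
    rwa [← h] at this
  · have := hp.sub_QFun_div_le_hFun hd hu hw
    rwa [h] at this

/-- In `w - Q(w) / q` the value grows with `q`, strictly when `Q(w) > 0`. The intermediate point `c
> 0` secures this, since `Q(u)` vanishes for `u = 0`. -/
theorem hFun_lt_hFun (hp : IsPressure p) (hd : 3 ≤ d) {u w : ℝ} (hu : 0 ≤ u) (hw : 0 ≤ w)
    (h : qFun d p u < qFun d p w) : hFun d p u < hFun d p w := by
  have hm := hp.monotoneOn_qFun hd
  obtain ⟨y, hy1, hy2⟩ := exists_between h
  obtain ⟨c, hc, rfl⟩ := hp.exists_qFun_eq hd ((hm (mem_Ici.2 le_rfl) hu hu).trans hy1.le)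
  have huc : u < c := lt_of_not_ge fun h' => (hm hc hu h').not_gt hy1
  have hc0 : 0 < c := hu.trans_lt huc
  have hqu := hp.qFun_pos (d := d) hu
  have hqc := hp.qFun_pos (d := d) hc
  have hle : hFun d p u ≤ hFun d p c := by
    refine le_trans ?_ (hp.sub_QFun_div_le_hFun hd hc hu)
    rw [hFun]
    have := div_le_div_of_nonneg_left (hp.QFun_nonneg (d := d) hu) hqu hy1.le
    linarith
  refine hle.trans_lt (lt_of_lt_of_le ?_ (hp.sub_QFun_div_le_hFun hd hw hc))
  rw [hFun]
  have := div_lt_div_of_pos_left (hp.QFun_pos hd hc0) hqc hy2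
  linarith

theorem hFun_lt_hFun_iff (hp : IsPressure p) (hd : 3 ≤ d) {u w : ℝ} (hu : 0 ≤ u) (hw : 0 ≤ w) :
    hFun d p u < hFun d p w ↔ qFun d p u < qFun d p w := by
  refine ⟨fun h => ?_, hp.hFun_lt_hFun hd hu hw⟩
  by_contra! h'
  rcases h'.lt_or_eq with h1 | h1
  · exact h.not_gt (hp.hFun_lt_hFun hd hw hu h1)
  · exact h.ne' (hp.hFun_congr hd hw hu h1)

theorem hFun_pos_iff (hp : IsPressure p) (hd : 3 ≤ d) {u : ℝ} (hu : 0 ≤ u) :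
    0 < hFun d p u ↔ qFun d p 0 < qFun d p u := by
  rw [← hp.hFun_lt_hFun_iff hd le_rfl hu, hFun_zero]

/-- The height as a function of `κ = 1 / q(u)`. -/
noncomputable def heightOf (d : ℕ) (p : ℝ → ℝ) (κ : ℝ) : ℝ :=
  sSup ((fun w => w - κ * QFun d p w) '' Ici 0)

theorem bddAbove_heightOf (hp : IsPressure p) (hd : 3 ≤ d) {κ : ℝ} (hκ : 0 < κ) :
    BddAbove ((fun w => w - κ * QFun d p w) '' Ici 0) := by
  rcases le_total (qFun d p 0) (1 / κ) with h | h
  · obtain ⟨u, hu, hqu⟩ := hp.exists_qFun_eq hd h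
    refine ⟨hFun d p u, ?_⟩
    rintro _ ⟨w, hw, rfl⟩
    refine le_trans (le_of_eq ?_) (hp.sub_QFun_div_le_hFun hd hu hw)
    simp only [hqu]
    field_simp
  · refine ⟨0, ?_⟩
    rintro _ ⟨w, hw, rfl⟩
    have hw0 : (0 : ℝ) ≤ w := hw
    have h1 := hp.QFun_support hd le_rfl hw0
    rw [QFun_zero] at h1
    have h2 : 1 ≤ κ * qFun d p 0 := by
      rw [div_le_iff₀ hκ] at h
      linarith
    have h3 := mul_le_mul_of_nonneg_left h1 hκ.le
    have h4 := mul_le_mul_of_nonneg_right h2 hw0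
    simp only
    linarith

theorem heightOf_eq_hFun (hp : IsPressure p) (hd : 3 ≤ d) {u : ℝ} (hu : 0 ≤ u) :
    heightOf d p (1 / qFun d p u) = hFun d p u := by
  refine IsGreatest.csSup_eq ⟨⟨u, hu, ?_⟩, ?_⟩
  · simp only [hFun]
    ring
  · rintro _ ⟨w, hw, rfl⟩
    refine le_trans (le_of_eq ?_) (hp.sub_QFun_div_le_hFun hd hu hw)
    simp only
    ring

theorem le_heightOf (hp : IsPressure p) (hd : 3 ≤ d) {κ w : ℝ} (hκ : 0 < κ) (hw : 0 ≤ w) :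
    w - κ * QFun d p w ≤ heightOf d p κ :=
  le_csSup (hp.bddAbove_heightOf hd hκ) ⟨w, hw, rfl⟩

/-- A supremum of affine functions of `κ` is convex, hence continuous on an open interval. -/
theorem continuousOn_heightOf (hp : IsPressure p) (hd : 3 ≤ d) :
    ContinuousOn (heightOf d p) (Ioi 0) := by
  refine ConvexOn.continuousOn isOpen_Ioi ⟨convex_Ioi 0, fun x hx y hy a b ha hb hab => ?_⟩
  refine csSup_le ⟨_, 0, mem_Ici.2 le_rfl, rfl⟩ ?_
  rintro _ ⟨w, hw, rfl⟩
  have h1 := mul_le_mul_of_nonneg_left (hp.le_heightOf hd hx hw) ha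
  have h2 := mul_le_mul_of_nonneg_left (hp.le_heightOf hd hy hw) hb
  simp only [smul_eq_mul]
  have h3 : w = (a + b) * w := by rw [hab, one_mul]
  nlinarith

end IsPressure

/-! ### The Newton profile -/

/-- The Newton profile with parameter `U`, as a supremum of affine functions. -/
noncomputable def newtonProfile (d : ℕ) (p : ℝ → ℝ) (U t : ℝ) : ℝ :=
  -hFun d p U + sSup ((fun w => t * w - QFun d p w / qFun d p U) '' Ici 0)

/-- `u ≥ 0` is a slope of the Newton profile with parameter `U` at the point `t`. -/
def IsContact (d : ℕ) (p : ℝ → ℝ) (U t u : ℝ) : Prop :=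
  0 ≤ u ∧ (qFun d p u = t * qFun d p U ∨ u = 0 ∧ t * qFun d p U ≤ qFun d p 0)

namespace IsPressure

variable {p : ℝ → ℝ} {d : ℕ} {U : ℝ}

theorem exists_isContact (hp : IsPressure p) (hd : 3 ≤ d) (hU : 0 ≤ U) {t : ℝ} (ht : t ≤ 1) :
    ∃ u, u ≤ U ∧ IsContact d p U t u := by
  have hq := hp.qFun_pos (d := d) hU
  rcases ht.lt_or_eq with ht | rfl
  · rcases le_total (t * qFun d p U) (qFun d p 0) with h | h
    · exact ⟨0, hU, le_rfl, Or.inr ⟨rfl, h⟩⟩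
    · obtain ⟨u, hu, hqu⟩ := hp.exists_qFun_eq hd h
      refine ⟨u, le_of_not_gt fun hUu => ?_, hu, Or.inl hqu⟩
      have := hp.monotoneOn_qFun hd hU hu hUu.le
      rw [hqu] at this
      nlinarith
  · exact ⟨U, le_rfl, hU, Or.inl (one_mul _).symm⟩

/-- The supporting line of `Q` at `u` has slope `t * q(U)`. At `u = 0` any slope up to `q(0)`
supports `Q` on `[0, ∞)`. -/
theorem isGreatest_of_isContact (hp : IsPressure p) (hd : 3 ≤ d) (hU : 0 ≤ U) {t u : ℝ}
    (h : IsContact d p U t u) :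
    IsGreatest ((fun w => t * w - QFun d p w / qFun d p U) '' Ici 0)
      (t * u - QFun d p u / qFun d p U) := by
  have hq := hp.qFun_pos (d := d) hU
  refine ⟨⟨u, h.1, rfl⟩, ?_⟩
  rintro _ ⟨w, hw, rfl⟩
  have hw0 : (0 : ℝ) ≤ w := hw
  have hs := hp.QFun_support hd h.1 hw0
  have key : QFun d p u + t * qFun d p U * (w - u) ≤ QFun d p w := by
    rcases h.2 with h1 | ⟨rfl, h1⟩
    · rwa [h1] at hs
    · nlinarith
  have h2 := div_le_div_of_nonneg_right key hq.le
  have h3 : (QFun d p u + t * qFun d p U * (w - u)) / qFun d p U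
      = QFun d p u / qFun d p U + t * (w - u) := by
    field_simp
  simp only
  linarith

theorem newtonProfile_of_isContact (hp : IsPressure p) (hd : 3 ≤ d) (hU : 0 ≤ U) {t u : ℝ}
    (h : IsContact d p U t u) :
    newtonProfile d p U t = -hFun d p U + (t * u - QFun d p u / qFun d p U) := by
  rw [newtonProfile, (hp.isGreatest_of_isContact hd hU h).csSup_eq]

theorem le_newtonProfile (hp : IsPressure p) (hd : 3 ≤ d) (hU : 0 ≤ U) {t w : ℝ} (ht : t ≤ 1)
    (hw : 0 ≤ w) :
    -hFun d p U + (t * w - QFun d p w / qFun d p U) ≤ newtonProfile d p U t := by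
  obtain ⟨u, -, hu⟩ := hp.exists_isContact hd hU ht
  rw [hp.newtonProfile_of_isContact hd hU hu]
  exact add_le_add le_rfl ((hp.isGreatest_of_isContact hd hU hu).2 ⟨w, hw, rfl⟩)

theorem newtonProfile_one (hp : IsPressure p) (hd : 3 ≤ d) (hU : 0 ≤ U) :
    newtonProfile d p U 1 = 0 := by
  rw [hp.newtonProfile_of_isContact hd hU ⟨hU, Or.inl (one_mul _).symm⟩, hFun]
  ring

theorem newtonProfile_flat (hp : IsPressure p) (hd : 3 ≤ d) (hU : 0 ≤ U) {t : ℝ}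
    (ht : t ≤ qFun d p 0 / qFun d p U) : newtonProfile d p U t = -hFun d p U := by
  rw [le_div_iff₀ (hp.qFun_pos hU)] at ht
  rw [hp.newtonProfile_of_isContact hd hU ⟨le_rfl, Or.inr ⟨rfl, ht⟩⟩, QFun_zero]
  ring

/-- All contact slopes can be taken at most `U`, so the profile is Lipschitz up to `t = 1`, and in
particular absolutely continuous there. -/
theorem newtonProfile_sub_le (hp : IsPressure p) (hd : 3 ≤ d) (hU : 0 ≤ U) {s t : ℝ}
    (hst : s ≤ t) (ht : t ≤ 1) :
    newtonProfile d p U t - newtonProfile d p U s ≤ U * (t - s) := by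
  obtain ⟨u, huU, hu⟩ := hp.exists_isContact hd hU ht
  have h1 := hp.newtonProfile_of_isContact hd hU hu
  have h2 := hp.le_newtonProfile hd hU (hst.trans ht) hu.1
  have h3 := mul_le_mul_of_nonneg_right huU (sub_nonneg.2 hst)
  linarith

theorem monotoneOn_newtonProfile (hp : IsPressure p) (hd : 3 ≤ d) (hU : 0 ≤ U) :
    MonotoneOn (newtonProfile d p U) (Icc 0 1) := by
  intro s hs t ht hst
  obtain ⟨u, huU, hu⟩ := hp.exists_isContact hd hU hs.2
  have h1 := hp.newtonProfile_of_isContact hd hU hu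
  have h2 := hp.le_newtonProfile hd hU ht.2 hu.1
  have h3 := mul_le_mul_of_nonneg_right hst hu.1
  linarith

theorem lipschitzOnWith_newtonProfile (hp : IsPressure p) (hd : 3 ≤ d) (hU : 0 ≤ U) :
    LipschitzOnWith U.toNNReal (newtonProfile d p U) (Icc 0 1) := by
  refine LipschitzOnWith.of_dist_le_mul fun s hs t ht => ?_
  rw [Real.coe_toNNReal _ hU, Real.dist_eq, Real.dist_eq]
  rcases le_total s t with h | h
  · have h1 := hp.monotoneOn_newtonProfile hd hU hs ht h
    have h2 := hp.newtonProfile_sub_le hd hU h ht.2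
    rw [abs_sub_comm, abs_of_nonneg (sub_nonneg.2 h1), abs_sub_comm,
      abs_of_nonneg (sub_nonneg.2 h)]
    exact h2
  · have h1 := hp.monotoneOn_newtonProfile hd hU ht hs h
    have h2 := hp.newtonProfile_sub_le hd hU h hs.2
    rw [abs_of_nonneg (sub_nonneg.2 h1), abs_of_nonneg (sub_nonneg.2 h)]
    exact h2

theorem isProfile_newtonProfile (hp : IsPressure p) (hd : 3 ≤ d) (hU : 0 ≤ U) :
    IsProfile (hFun d p U) (newtonProfile d p U) where
  convexOn := by
    refine ⟨convex_Icc 0 1, fun x hx y hy a b ha hb hab => ?_⟩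
    have hz := (convex_Icc (0 : ℝ) 1) hx hy ha hb hab
    obtain ⟨u, -, hu⟩ := hp.exists_isContact hd hU hz.2
    rw [hp.newtonProfile_of_isContact hd hU hu]
    have h1 := mul_le_mul_of_nonneg_left (hp.le_newtonProfile hd hU hx.2 hu.1) ha
    have h2 := mul_le_mul_of_nonneg_left (hp.le_newtonProfile hd hU hy.2 hu.1) hb
    simp only [smul_eq_mul]
    refine le_trans (le_of_eq ?_) (add_le_add h1 h2)
    linear_combination (hFun d p U + QFun d p u / qFun d p U) * (hab)
  nonpos := fun t ht => by
    rw [← hp.newtonProfile_one hd hU]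
    exact hp.monotoneOn_newtonProfile hd hU ht (right_mem_Icc.2 zero_le_one) ht.2
  monotoneOn := hp.monotoneOn_newtonProfile hd hU
  continuousOn := (hp.lipschitzOnWith_newtonProfile hd hU).continuousOn
  apply_zero := hp.newtonProfile_flat hd hU
    (div_nonneg (hp.qFun_pos le_rfl).le (hp.qFun_pos hU).le)

theorem isNewtonProfile_newtonProfile (hp : IsPressure p) (hd : 3 ≤ d) (hU : 0 ≤ U) :
    IsNewtonProfile d p U (newtonProfile d p U) := by
  have hq := hp.qFun_pos (d := d) hU
  have hq0 := hp.qFun_pos (d := d) le_rfl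
  have hm := hp.monotoneOn_qFun hd
  refine ⟨div_pos hq0 hq, (div_le_one hq).2 (hm (mem_Ici.2 le_rfl) hU hU), fun h => ?_,
    fun t ht => hp.newtonProfile_flat hd hU ht.2, ?_, fun u hu => ?_, ?_⟩
  · exact (div_lt_one hq).2 ((hp.hFun_pos_iff hd hU).1 h)
  · refine Subset.antisymm ?_ fun t ht => ?_
    · rintro _ ⟨u, hu, rfl⟩
      exact ⟨div_le_div_of_nonneg_right (hm (mem_Ici.2 le_rfl) hu.1 hu.1) hq.le,
        (div_le_one hq).2 (hm hu.1 hU hu.2)⟩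
    · obtain ⟨u, huU, hu⟩ := hp.exists_isContact hd hU ht.2
      have ht1 := ht.1
      rw [div_le_iff₀ hq] at ht1
      refine ⟨u, ⟨hu.1, huU⟩, ?_⟩
      rcases hu.2 with h | ⟨rfl, h⟩
      · simp only [h]
        field_simp
      · simp only [le_antisymm ht1 h]
        field_simp
  · rw [hp.newtonProfile_of_isContact hd hU (u := u) ⟨hu.1, Or.inl (by field_simp)⟩]
    ring
  · refine ⟨convex_Icc _ 1, fun x hx y hy hxy a b ha hb hab => ?_⟩
    have hz := (convex_Icc (qFun d p 0 / qFun d p U) 1) hx hy ha.le hb.le hab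
    have hc : ∀ t ∈ Icc (qFun d p 0 / qFun d p U) 1,
        ∃ u, IsContact d p U t u ∧ qFun d p u = t * qFun d p U := fun t ht => by
      obtain ⟨u, -, hu⟩ := hp.exists_isContact hd hU ht.2
      refine ⟨u, hu, ?_⟩
      have ht1 := ht.1
      rw [div_le_iff₀ hq] at ht1
      rcases hu.2 with h | ⟨rfl, h⟩
      · exact h
      · exact le_antisymm ht1 h
    obtain ⟨u, hu, hqu⟩ := hc _ hz
    -- On the curved part distinct `t` have distinct values of `q` at their contacts, so the
    -- touching line at one point lies strictly below the profile at the others.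
    have key : ∀ t ∈ Icc (qFun d p 0 / qFun d p U) 1, t ≠ a • x + b • y →
        -hFun d p U + (t * u - QFun d p u / qFun d p U) < newtonProfile d p U t := by
      intro t ht hne
      obtain ⟨v, hv, hqv⟩ := hc t ht
      rw [hp.newtonProfile_of_isContact hd hU hv]
      have h1 := hp.QFun_support_strict hd hv.1 hu.1 (by
        rw [hqu, hqv]
        exact fun h => hne (mul_right_cancel₀ hq.ne' h))
      rw [hqv] at h1
      have h2 := div_lt_div_of_pos_right h1 hq
      have h3 : (QFun d p v + t * qFun d p U * (u - v)) / qFun d p U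
          = QFun d p v / qFun d p U + t * (u - v) := by
        field_simp
      linarith
    have hx' : x ≠ a • x + b • y := fun h => hxy (by
      simp only [smul_eq_mul] at h
      have : b * (x - y) = 0 := by linear_combination h + x * hab
      rcases mul_eq_zero.1 this with h | h <;> linarith)
    have hy' : y ≠ a • x + b • y := fun h => hxy (by
      simp only [smul_eq_mul] at h
      have : a * (y - x) = 0 := by linear_combination h + y * hab
      rcases mul_eq_zero.1 this with h | h <;> linarith)
    have h1 := mul_lt_mul_of_pos_left (key x hx hx') ha
    have h2 := mul_lt_mul_of_pos_left (key y hy hy') hb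
    rw [hp.newtonProfile_of_isContact hd hU hu]
    simp only [smul_eq_mul]
    refine lt_of_eq_of_lt ?_ (add_lt_add h1 h2)
    linear_combination (hFun d p U + QFun d p u / qFun d p U) * (hab)

/-- A line of slope `u` touches the profile from below at `t`. In particular there is only one
contact wherever the profile is differentiable. -/
theorem deriv_newtonProfile_of_isContact (hp : IsPressure p) (hd : 3 ≤ d) (hU : 0 ≤ U)
    {t u : ℝ} (ht : t < 1) (hf : DifferentiableAt ℝ (newtonProfile d p U) t)
    (hu : IsContact d p U t u) : deriv (newtonProfile d p U) t = u := by
  have hloc : IsLocalMin (fun s => newtonProfile d p U s - s * u) t := by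
    filter_upwards [gt_mem_nhds ht] with s hs
    have h1 := hp.le_newtonProfile hd hU hs.le hu.1
    rw [hp.newtonProfile_of_isContact hd hU hu]
    linarith
  have hder : HasDerivAt (fun s => newtonProfile d p U s - s * u)
      (deriv (newtonProfile d p U) t - 1 * u) t :=
    hf.hasDerivAt.sub ((hasDerivAt_id t).mul_const u)
  linarith [hloc.hasDerivAt_eq_zero hder]

/-- The Euler equation `p̄'(u) * t ^ (d - 2) = p̄'(U)` is `q(u) = t * q(U)` raised to the power `d -
2`. The endpoint inequality at `u = 0` is treated likewise. -/
theorem isContact_of_min (hp : IsPressure p) (hd : 3 ≤ d) (hU : 0 ≤ U) {t u : ℝ} (ht : 0 < t)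
    (hu : 0 ≤ u) (hmin : ∀ w, 0 ≤ w →
      convEnv p u + (-convEnvDeriv p U / t ^ (d - 2)) * u
        ≤ convEnv p w + (-convEnvDeriv p U / t ^ (d - 2)) * w) :
    IsContact d p U t u := by
  have hθ : 0 < t ^ (d - 2) := pow_pos ht _
  have hd2 : d - 2 ≠ 0 := by omega
  have hqU := hp.qFun_pos (d := d) hU
  have hlU := hp.neg_convEnvDeriv_mul_qFun_pow hd hU
  have hlu := hp.neg_convEnvDeriv_mul_qFun_pow hd hu
  have hlam : 0 < -convEnvDeriv p U := neg_pos.2 (hp.convEnvDeriv_neg hU)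
  refine ⟨hu, ?_⟩
  rcases hp.deriv_of_min_convEnv hu hmin with h | ⟨rfl, h⟩
  · left
    rw [h, neg_neg, div_mul_eq_mul_div, div_eq_one_iff_eq hθ.ne'] at hlu
    refine (pow_left_inj₀ (hp.qFun_pos hu).le (mul_pos ht hqU).le hd2).1 ?_
    rw [mul_pow, ← hlu]
    linear_combination (-qFun d p u ^ (d - 2)) * hlU
  · right
    refine ⟨rfl, (pow_le_pow_iff_left₀ (mul_pos ht hqU).le (hp.qFun_pos le_rfl).le hd2).1 ?_⟩
    have h1 : -convEnvDeriv p 0 * t ^ (d - 2) ≤ -convEnvDeriv p U := by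
      rw [← le_div_iff₀ hθ]
      have : -(-convEnvDeriv p U / t ^ (d - 2)) ≤ convEnvDeriv p 0 := h
      linarith
    have h0 : 0 < qFun d p 0 ^ (d - 2) := pow_pos (hp.qFun_pos le_rfl) _
    have hUp : 0 < qFun d p U ^ (d - 2) := pow_pos hqU _
    rw [mul_pow]
    have h2 := mul_le_mul_of_nonneg_right h1 (mul_pos h0 hUp).le
    have h3 : -convEnvDeriv p 0 * t ^ (d - 2) * (qFun d p 0 ^ (d - 2) * qFun d p U ^ (d - 2))
        = t ^ (d - 2) * qFun d p U ^ (d - 2) := by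
      linear_combination (t ^ (d - 2) * qFun d p U ^ (d - 2)) * hlu
    have h4 : -convEnvDeriv p U * (qFun d p 0 ^ (d - 2) * qFun d p U ^ (d - 2))
        = qFun d p 0 ^ (d - 2) := by
      linear_combination (qFun d p 0 ^ (d - 2)) * hlU
    linarith

end IsPressure

/-- For almost every `t`, the slope `f' t` is the unique minimizer of `p w t ^ (d - 2) + μ w`
over `w ≥ 0`. -/
def MinimizesSlopes (d : ℕ) (p : ℝ → ℝ) (μ : ℝ) (f : ℝ → ℝ) : Prop :=
  ∀ᵐ t, t ∈ Ioo (0 : ℝ) 1 → 0 ≤ deriv f t ∧ ∀ w, 0 ≤ w → w ≠ deriv f t →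
    p (deriv f t) * t ^ (d - 2) + μ * deriv f t < p w * t ^ (d - 2) + μ * w

theorem IsProfile.ae_differentiableAt {h : ℝ} {f : ℝ → ℝ} (hf : IsProfile h f) :
    ∀ᵐ t, t ∈ Ioo (0 : ℝ) 1 → DifferentiableAt ℝ f t := by
  filter_upwards [(hf.monotoneOn.mono Ioo_subset_Icc_self).ae_differentiableWithinAt_of_mem]
    with t ht ht'
  exact (ht ht').differentiableAt (isOpen_Ioo.mem_nhds ht')

/-! ### Pointwise minimality of the slopes -/

namespace IsPressure

variable {p : ℝ → ℝ} {d : ℕ} {U : ℝ}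

theorem minimizesSlopes_newtonProfile (hp : IsPressure p) (hd : 3 ≤ d) (hU : 0 ≤ U) :
    MinimizesSlopes d p (-convEnvDeriv p U) (newtonProfile d p U) := by
  filter_upwards [(hp.isProfile_newtonProfile hd hU).ae_differentiableAt] with t htd ht
  have hθ : 0 < t ^ (d - 2) := pow_pos ht.1 _
  have hlam : 0 < -convEnvDeriv p U := neg_pos.2 (hp.convEnvDeriv_neg hU)
  obtain ⟨u, hu, heq, hmin⟩ := hp.exists_min_convEnv (div_pos hlam hθ)
  have hc := hp.isContact_of_min hd hU ht.1 hu hmin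
  have hder := hp.deriv_newtonProfile_of_isContact hd hU ht.2 (htd ht) hc
  rw [hder]
  refine ⟨hu, fun w hw hwu => ?_⟩
  by_contra! hle
  refine hwu ?_
  rw [← hder]
  have hscale : ∀ x y : ℝ, x + -convEnvDeriv p U / t ^ (d - 2) * y
      = (x * t ^ (d - 2) + -convEnvDeriv p U * y) / t ^ (d - 2) := fun x y => by
    field_simp
  -- A competing minimizer `w` for `p` also minimizes for the envelope, which lies below `p` and
  -- agrees with it at `u`. So `w` is a contact, and contacts are unique at points of
  -- differentiability.
  refine (hp.deriv_newtonProfile_of_isContact hd hU ht.2 (htd ht)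
    (hp.isContact_of_min hd hU ht.1 hw fun v hv => le_trans ?_ (hmin v hv))).symm
  rw [heq]
  refine le_trans (add_le_add (hp.convEnv_le hw) le_rfl) ?_
  rw [hscale, hscale]
  exact div_le_div_of_nonneg_right hle hθ.le

/-- Strictness survives in the limiting case `μ = -p̄'(0)` because `t ^ (d - 2) < 1`. -/
theorem minimizesSlopes_zero (hp : IsPressure p) (hd : 3 ≤ d) {μ : ℝ}
    (hμ : -convEnvDeriv p 0 ≤ μ) : MinimizesSlopes d p μ (fun _ => 0) := by
  refine Eventually.of_forall fun t ht => ?_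
  simp only [deriv_const]
  refine ⟨le_rfl, fun w hw hw0 => ?_⟩
  have hwpos : 0 < w := lt_of_le_of_ne hw (Ne.symm hw0)
  have hθ : 0 < t ^ (d - 2) := pow_pos ht.1 _
  have hθ1 : t ^ (d - 2) < 1 := pow_lt_one₀ ht.1.le ht.2 (by omega)
  have h1 := (hp.support_le_convEnv le_rfl hw).trans (hp.convEnv_le hw)
  rw [hp.convEnv_zero] at h1
  have h2 := mul_le_mul_of_nonneg_right h1 hθ.le
  have h3 := hp.convEnvDeriv_neg (le_refl (0 : ℝ))
  have h4 : 0 < (convEnvDeriv p 0 * t ^ (d - 2) + μ) * w :=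
    mul_pos (by nlinarith) hwpos
  nlinarith

end IsPressure

/-! ### The minimization problem for one part of the surface -/

theorem ae_uIoc_of_ae_Ioo {P : ℝ → Prop} (h : ∀ᵐ t, t ∈ Ioo (0 : ℝ) 1 → P t) :
    ∀ᵐ t, t ∈ uIoc (0 : ℝ) 1 → P t := by
  filter_upwards [h, compl_mem_ae_iff.2 (measure_singleton (1 : ℝ))] with t ht ht1 htm
  rw [uIoc_of_le zero_le_one] at htm
  exact ht ⟨htm.1, lt_of_le_of_ne htm.2 ht1⟩

namespace IsProfile

variable {h : ℝ} {f : ℝ → ℝ}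

theorem deriv_nonneg (hf : IsProfile h f) {t : ℝ} (ht : t ∈ Ioo (0 : ℝ) 1) : 0 ≤ deriv f t := by
  rw [← derivWithin_of_mem_nhds (Icc_mem_nhds ht.1 ht.2)]
  exact hf.monotoneOn.derivWithin_nonneg

theorem intervalIntegrable_deriv (hf : IsProfile h f) :
    IntervalIntegrable (deriv f) volume 0 1 := by
  have := hf.monotoneOn
  rw [← uIcc_of_le (zero_le_one' ℝ)] at this
  exact this.intervalIntegrable_deriv

theorem integral_deriv_le (hf : IsProfile h f) : ∫ t in (0 : ℝ)..1, deriv f t ≤ f 1 - f 0 := by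
  have hm := hf.monotoneOn
  have hle : f 0 ≤ f 1 := hm (left_mem_Icc.2 zero_le_one) (right_mem_Icc.2 zero_le_one)
    zero_le_one
  rw [← uIcc_of_le (zero_le_one' ℝ)] at hm
  have h1 := hm.intervalIntegral_deriv_mem_uIcc
  rw [uIcc_of_le (sub_nonneg.2 hle)] at h1
  exact h1.2

/-- Slopes may blow up at `1`, but by convexity those on `[0, b]` are bounded by the slope of the
chord from `b` to `1`. -/
theorem absolutelyContinuousOnInterval (hf : IsProfile h f) {b : ℝ} (hb0 : 0 ≤ b) (hb : b < 1) :
    AbsolutelyContinuousOnInterval f 0 b := by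
  have h1 : (1 : ℝ) ∈ Icc (0 : ℝ) 1 := right_mem_Icc.2 zero_le_one
  have hb' : b ∈ Icc (0 : ℝ) 1 := ⟨hb0, hb.le⟩
  set K := (f 1 - f b) / (1 - b) with hK
  have hK0 : 0 ≤ K := div_nonneg (sub_nonneg.2 (hf.monotoneOn hb' h1 hb.le)) (by linarith)
  have key : ∀ x y, 0 ≤ x → x ≤ y → y ≤ b → f y - f x ≤ K * (y - x) := by
    intro x y hx hxy hyb
    rcases hxy.eq_or_lt with rfl | hxy
    · simp
    have hy1 : y < 1 := hyb.trans_lt hb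
    have hx' : x ∈ Icc (0 : ℝ) 1 := ⟨hx, by linarith⟩
    have hy' : y ∈ Icc (0 : ℝ) 1 := ⟨by linarith, hy1.le⟩
    have s1 := hf.convexOn.slope_mono_adjacent hx' h1 hxy hy1
    have s2 := hf.convexOn.slope_mono h1 ⟨hy', hy1.ne⟩ ⟨hb', hb.ne⟩ hyb
    rw [slope_comm, slope_def_field, slope_comm, slope_def_field] at s2
    have s3 := s1.trans s2
    rwa [div_le_iff₀ (sub_pos.2 hxy)] at s3
  have hlip : LipschitzOnWith K.toNNReal f (uIcc 0 b) := by
    rw [uIcc_of_le hb0]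
    refine LipschitzOnWith.of_dist_le_mul fun s hs t ht => ?_
    rw [Real.coe_toNNReal _ hK0, Real.dist_eq, Real.dist_eq]
    have hs' : s ∈ Icc (0 : ℝ) 1 := ⟨hs.1, hs.2.trans hb.le⟩
    have ht' : t ∈ Icc (0 : ℝ) 1 := ⟨ht.1, ht.2.trans hb.le⟩
    rcases le_total s t with h | h
    · rw [abs_sub_comm, abs_of_nonneg (sub_nonneg.2 (hf.monotoneOn hs' ht' h)), abs_sub_comm,
        abs_of_nonneg (sub_nonneg.2 h)]
      exact key s t hs.1 h ht.2
    · rw [abs_of_nonneg (sub_nonneg.2 (hf.monotoneOn ht' hs' h)), abs_of_nonneg (sub_nonneg.2 h)]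
      exact key t s ht.1 h hs.2
  exact hlip.absolutelyContinuousOnInterval

/-- A profile is determined by its slopes and its value at `1`. -/
theorem eqOn_of_ae_deriv_eq {h' : ℝ} {g : ℝ → ℝ} (hf : IsProfile h f) (hg : IsProfile h' g)
    (hd : ∀ᵐ t, t ∈ Ioo (0 : ℝ) 1 → deriv g t = deriv f t) (h1 : g 1 = f 1) :
    EqOn g f (Icc 0 1) := by
  have key : ∀ b, 0 ≤ b → b < 1 → g b - g 0 = f b - f 0 := by
    intro b hb0 hb
    rw [← (hf.absolutelyContinuousOnInterval hb0 hb).integral_deriv_eq_sub,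
      ← (hg.absolutelyContinuousOnInterval hb0 hb).integral_deriv_eq_sub]
    refine intervalIntegral.integral_congr_ae ?_
    filter_upwards [hd] with t ht htm
    rw [uIoc_of_le hb0] at htm
    exact ht ⟨htm.1, htm.2.trans_lt hb⟩
  have hcont : ContinuousOn (fun t => g t - f t) (Icc 0 1) := hg.continuousOn.sub hf.continuousOn
  -- Equality of increments on each `[0, b]` passes to `b = 1` by continuity.
  have h10 : g 1 - f 1 = g 0 - f 0 := by
    have ht := (hcont 1 (right_mem_Icc.2 zero_le_one)).mono_left
      (nhdsWithin_mono 1 (Ico_subset_Icc_self))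
    have hne : (𝓝[Ico (0 : ℝ) 1] 1).NeBot := by
      rw [← mem_closure_iff_nhdsWithin_neBot, closure_Ico zero_ne_one]
      exact right_mem_Icc.2 zero_le_one
    refine tendsto_nhds_unique ht (tendsto_const_nhds.congr' ?_)
    filter_upwards [self_mem_nhdsWithin] with b hb
    linarith [key b hb.1 hb.2]
  intro t ht
  rcases ht.2.eq_or_lt with rfl | ht1
  · exact h1
  · linarith [key t ht.1 ht1]

end IsProfile

/-! ### Resistance and the penalized problem -/

namespace IsPressure

variable {p f : ℝ → ℝ} {d : ℕ} {h μ : ℝ}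

theorem intervalIntegrable_weighted (hp : IsPressure p) (f : ℝ → ℝ) (n : ℕ) :
    IntervalIntegrable (fun t => p (deriv f t) * t ^ n) volume 0 1 := by
  obtain ⟨M, hM⟩ := hp.bounded
  have hc : IntervalIntegrable (fun t : ℝ => t ^ n) volume 0 1 :=
    (continuous_pow n).intervalIntegrable 0 1
  rw [intervalIntegrable_iff] at hc ⊢
  exact hc.bdd_mul (hp.differentiable.continuous.measurable.comp
    (measurable_deriv f)).aestronglyMeasurable (Eventually.of_forall fun t => hM (deriv f t))

theorem partResistance_eq_mul (d : ℕ) (p f : ℝ → ℝ) :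
    partResistance d p f = ((d : ℝ) - 1) * ∫ t in (0 : ℝ)..1, p (deriv f t) * t ^ (d - 2) := by
  rw [partResistance, ← intervalIntegral.integral_const_mul]
  congr 1
  funext t
  ring

theorem absolutelyContinuousOnInterval_of_sub_le {Ψ : ℝ → ℝ} {n : ℕ} {M : ℝ} (hM0 : 0 ≤ M)
    (hΨ : ∀ s t, 0 ≤ s → 0 ≤ t → Ψ t - Ψ s ≤ M * |t ^ n - s ^ n|) :
    AbsolutelyContinuousOnInterval Ψ 0 1 := by
  have key : ∀ s ∈ Icc (0 : ℝ) 1, ∀ t ∈ Icc (0 : ℝ) 1, Ψ t - Ψ s ≤ M * n * |t - s| := by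
    intro s hs t ht
    refine (hΨ s t hs.1 ht.1).trans ?_
    rw [mul_assoc]
    refine mul_le_mul_of_nonneg_left ((abs_pow_sub_pow_le t s n).trans ?_) hM0
    have hmax : max |t| |s| ^ (n - 1) ≤ 1 := pow_le_one₀ (le_max_of_le_left (abs_nonneg _))
      (max_le (abs_le.2 ⟨by linarith [ht.1], ht.2⟩) (abs_le.2 ⟨by linarith [hs.1], hs.2⟩))
    calc |t - s| * n * max |t| |s| ^ (n - 1) ≤ |t - s| * n * 1 :=
          mul_le_mul_of_nonneg_left hmax (by positivity)
      _ = n * |t - s| := by ring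
  have hK : 0 ≤ M * n := by positivity
  have hlip : LipschitzOnWith (M * n).toNNReal Ψ (uIcc 0 1) := by
    rw [uIcc_of_le zero_le_one]
    refine LipschitzOnWith.of_dist_le_mul fun s hs t ht => ?_
    rw [Real.coe_toNNReal _ hK, Real.dist_eq, Real.dist_eq, abs_le]
    have h1 := key s hs t ht
    have h2 := key t ht s hs
    rw [abs_sub_comm t s] at h1
    exact ⟨by linarith, h2⟩
  exact hlip.absolutelyContinuousOnInterval

/-- The resistance of a profile whose slopes minimize `p w t ^ (d - 2) + μ w`. -/
theorem partResistance_eq (hp : IsPressure p) (hd : 3 ≤ d) (hμ : 0 < μ) (hf : IsProfile h f)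
    (hf1 : f 1 = 0) (hfac : AbsolutelyContinuousOnInterval f 0 1)
    (hmin : MinimizesSlopes d p μ f) {c : ℝ} (hc : IsLeast ((fun w => p w + μ * w) '' Ici 0) c) :
    partResistance d p f = c - μ * h := by
  obtain ⟨M, hM⟩ := hp.bounded
  have hM0 : 0 ≤ M := (abs_nonneg _).trans (hM 0)
  have hd2 : d - 2 ≠ 0 := by omega
  have hex : ∀ t, ∃ w₀, 0 ≤ t → 0 ≤ w₀ ∧
      ∀ w, 0 ≤ w → p w₀ * t ^ (d - 2) + μ * w₀ ≤ p w * t ^ (d - 2) + μ * w := by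
    intro t
    by_cases ht : 0 < t
    · have hθ : 0 < t ^ (d - 2) := pow_pos ht _
      obtain ⟨w₀, hw₀, hm⟩ := hp.exists_min (div_pos hμ hθ)
      refine ⟨w₀, fun _ => ⟨hw₀, fun w hw => ?_⟩⟩
      have h1 := mul_le_mul_of_nonneg_right (hm w hw) hθ.le
      have h2 : ∀ v, (p v + μ / t ^ (d - 2) * v) * t ^ (d - 2) = p v * t ^ (d - 2) + μ * v :=
        fun v => by field_simp
      rwa [h2, h2] at h1
    -- At `t = 0` the weight vanishes since `d ≥ 3`, and the slope `0` is optimal.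
    · refine ⟨0, fun ht0 => ⟨le_rfl, fun w hw => ?_⟩⟩
      rw [le_antisymm (not_lt.1 ht) ht0, zero_pow hd2]
      simpa using mul_nonneg hμ.le hw
  choose u hu using hex
  set Ψ : ℝ → ℝ := fun t => p (u t) * t ^ (d - 2) + μ * u t with hΨ
  have hΨle : ∀ t w, 0 ≤ t → 0 ≤ w → Ψ t ≤ p w * t ^ (d - 2) + μ * w :=
    fun t w ht hw => (hu t ht).2 w hw
  -- The minimizer at `s` used as a competitor at `t` bounds `Ψ t - Ψ s`, with no regularity of `u`
  -- needed.
  have hΨac : AbsolutelyContinuousOnInterval Ψ 0 1 := by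
    refine absolutelyContinuousOnInterval_of_sub_le (n := d - 2) hM0 fun s t hs ht => ?_
    have h1 := hΨle t (u s) ht (hu s hs).1
    have h2 : p (u s) * (t ^ (d - 2) - s ^ (d - 2)) ≤ M * |t ^ (d - 2) - s ^ (d - 2)| :=
      (le_abs_self _).trans (by
        rw [abs_mul]
        exact mul_le_mul_of_nonneg_right (hM _) (abs_nonneg _))
    simp only [hΨ] at h1 ⊢
    linarith
  have hid : AbsolutelyContinuousOnInterval (fun t : ℝ => t) 0 1 :=
    (LipschitzWith.id.lipschitzOnWith (s := uIcc (0 : ℝ) 1)).absolutelyContinuousOnInterval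
  have hE := ((hid.mul hΨac).sub (hfac.const_mul μ)).integral_deriv_eq_sub
  have hΨ1 : Ψ 1 = c := by
    obtain ⟨⟨v, hv, hvc⟩, hlow⟩ := hc
    refine le_antisymm ?_ ?_
    · have := hΨle 1 v zero_le_one hv
      rw [one_pow, mul_one] at this
      exact this.trans_eq hvc
    · have := hlow ⟨u 1, (hu 1 zero_le_one).1, rfl⟩
      simpa [hΨ] using this
  -- By the envelope theorem `Ψ' = (d - 2) * p(f') * t ^ (d - 3)`, so `(t * Ψ)' = (d - 1) * p(f') *
  -- t ^ (d - 2) + μ * f'`. The resistance is thus the integral of an exact derivative.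
  have hcongr : partResistance d p f = ∫ t in (0 : ℝ)..1,
      deriv ((fun t : ℝ => t) * Ψ - fun x => μ * f x) t := by
    refine intervalIntegral.integral_congr_ae (ae_uIoc_of_ae_Ioo ?_)
    filter_upwards [hmin, hf.ae_differentiableAt, hΨac.ae_differentiableAt] with t h1 h2 h3 ht
    have hfd := (h2 ht).hasDerivAt
    have hΨd := (h3 (by rw [uIcc_of_le zero_le_one]; exact Ioo_subset_Icc_self ht)).hasDerivAt
    obtain ⟨hv0, hvmin⟩ := h1 ht
    set v := deriv f t with hv
    have hΨt : Ψ t = p v * t ^ (d - 2) + μ * v := by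
      refine le_antisymm (hΨle t v ht.1.le hv0) ?_
      by_cases huv : u t = v
      · simp only [hΨ, huv, le_refl]
      · exact (hvmin (u t) (hu t ht.1.le).1 huv).le
    have hloc : IsLocalMax (fun s => Ψ s - (p v * s ^ (d - 2) + μ * v)) t := by
      filter_upwards [lt_mem_nhds ht.1] with s hs
      have := hΨle s v hs.le hv0
      rw [hΨt]
      linarith
    have hder0 := hloc.hasDerivAt_eq_zero
      (hΨd.sub (((hasDerivAt_pow (d - 2) t).const_mul (p v)).add_const (μ * v)))
    have hEd := ((hasDerivAt_id' t).mul hΨd).sub (hfd.const_mul μ)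
    rw [hEd.deriv, hΨt, sub_eq_zero.1 hder0]
    have hpow : t * t ^ (d - 2 - 1) = t ^ (d - 2) := by
      rw [← pow_succ', Nat.sub_add_cancel (by omega)]
    rw [Nat.cast_sub (by omega : 2 ≤ d)]
    push_cast
    linear_combination (-(p v * ((d : ℝ) - 2))) * hpow
  rw [hcongr, hE]
  simp only [Pi.sub_apply, Pi.mul_apply, hΨ1, hf1, hf.apply_zero]
  ring

/-- The profile whose slopes minimize `p w t ^ (d - 2) + μ w` minimizes the resistance penalized
by the height, and it is the only minimizer. -/
theorem penalized_le (hp : IsPressure p) (hd : 3 ≤ d) (hμ : 0 < μ) (hf : IsProfile h f)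
    (hf1 : f 1 = 0) (hfac : AbsolutelyContinuousOnInterval f 0 1)
    (hmin : MinimizesSlopes d p μ f) {z : ℝ} {g : ℝ → ℝ} (hg : IsProfile z g) :
    partResistance d p f + μ * ((d : ℝ) - 1) * h ≤ partResistance d p g + μ * ((d : ℝ) - 1) * z ∧
    (partResistance d p g + μ * ((d : ℝ) - 1) * z ≤ partResistance d p f + μ * ((d : ℝ) - 1) * h →
      EqOn g f (Icc 0 1)) := by
  have hd1 : (0 : ℝ) < (d : ℝ) - 1 := by linarith [sub_two_pos hd]
  rw [partResistance_eq_mul, partResistance_eq_mul]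
  have hfint := hfac.integral_deriv_eq_sub
  rw [hf1, hf.apply_zero] at hfint
  have hgint := hg.integral_deriv_le
  rw [hg.apply_zero] at hgint
  have hg1 := hg.nonpos 1 (right_mem_Icc.2 zero_le_one)
  set Ff : ℝ → ℝ := fun t => p (deriv f t) * t ^ (d - 2) + μ * deriv f t with hFf
  set Fg : ℝ → ℝ := fun t => p (deriv g t) * t ^ (d - 2) + μ * deriv g t with hFg
  have If1 := hp.intervalIntegrable_weighted f (d - 2)
  have Ig1 := hp.intervalIntegrable_weighted g (d - 2)
  have If2 := hf.intervalIntegrable_deriv.const_mul μ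
  have Ig2 := hg.intervalIntegrable_deriv.const_mul μ
  have If : IntervalIntegrable Ff volume 0 1 := If1.add If2
  have Ig : IntervalIntegrable Fg volume 0 1 := Ig1.add Ig2
  have ef : ∫ t in (0 : ℝ)..1, Ff t
      = (∫ t in (0 : ℝ)..1, p (deriv f t) * t ^ (d - 2)) + μ * h := by
    rw [hFf, intervalIntegral.integral_add If1 If2, intervalIntegral.integral_const_mul, hfint]
    ring
  have eg : ∫ t in (0 : ℝ)..1, Fg t
      = (∫ t in (0 : ℝ)..1, p (deriv g t) * t ^ (d - 2)) + μ * ∫ t in (0 : ℝ)..1, deriv g t := by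
    rw [hFg, intervalIntegral.integral_add Ig1 Ig2, intervalIntegral.integral_const_mul]
  have hle : ∀ᵐ t, t ∈ Ioo (0 : ℝ) 1 → Ff t ≤ Fg t := by
    filter_upwards [hmin] with t ht ht'
    by_cases he : deriv g t = deriv f t
    · simp only [hFf, hFg, he, le_refl]
    · exact ((ht ht').2 _ (hg.deriv_nonneg ht') he).le
  have hle' : 0 ≤ᵐ[volume.restrict (Ioc 0 1)] fun t => Fg t - Ff t := by
    rw [EventuallyLE, ae_restrict_iff' measurableSet_Ioc]
    have := ae_uIoc_of_ae_Ioo hle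
    rw [uIoc_of_le zero_le_one] at this
    filter_upwards [this] with t ht ht'
    exact sub_nonneg.2 (ht ht')
  have hdiff : ∫ t in (0 : ℝ)..1, (Fg t - Ff t)
      = (∫ t in (0 : ℝ)..1, Fg t) - ∫ t in (0 : ℝ)..1, Ff t :=
    intervalIntegral.integral_sub Ig If
  have hnn : 0 ≤ ∫ t in (0 : ℝ)..1, (Fg t - Ff t) := by
    rw [intervalIntegral.integral_of_le zero_le_one]
    exact integral_nonneg_of_ae hle'
  -- Both possible losses, in `∫ g' ≤ g 1 - g 0` and in `g 1 ≤ 0`, favour the inequality. Equality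
  -- in the penalized problem then forces `g 1 = 0` and equal slopes almost everywhere.
  have hμg := mul_le_mul_of_nonneg_left hgint hμ.le
  set A := ∫ t in (0 : ℝ)..1, p (deriv f t) * t ^ (d - 2)
  set B := ∫ t in (0 : ℝ)..1, p (deriv g t) * t ^ (d - 2)
  have hμg1 := mul_nonneg_of_nonpos_of_nonpos (neg_nonpos.2 hμ.le) hg1
  have hAB : A + μ * h ≤ B + μ * z := by linarith
  refine ⟨by nlinarith, fun hBA => ?_⟩
  have hBA' : B + μ * z ≤ A + μ * h := by
    refine le_of_mul_le_mul_left ?_ hd1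
    linarith
  have hg1' : g 1 = 0 := by
    refine le_antisymm hg1 (le_of_mul_le_mul_left ?_ hμ)
    linarith
  have hzero : ∫ t in (0 : ℝ)..1, (Fg t - Ff t) = 0 := le_antisymm (by linarith) hnn
  have hae : (fun t => Fg t - Ff t) =ᵐ[volume.restrict (Ioc 0 1)] 0 := by
    have hI := (intervalIntegrable_iff_integrableOn_Ioc_of_le zero_le_one).1 (Ig.sub If)
    rw [intervalIntegral.integral_of_le zero_le_one] at hzero
    exact (integral_eq_zero_iff_of_nonneg_ae hle' hI).1 hzero
  refine hf.eqOn_of_ae_deriv_eq hg ?_ (hg1'.trans hf1.symm)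
  filter_upwards [hmin, (ae_restrict_iff' measurableSet_Ioc).1 hae] with t ht hz ht'
  by_contra he
  have h1 := (ht ht').2 _ (hg.deriv_nonneg ht') he
  have h2 : Fg t - Ff t = 0 := hz (Ioo_subset_Ioc_self ht')
  simp only [hFf, hFg] at h2
  linarith

end IsPressure

/-! ### The pressure functions of the medium -/

theorem hasDerivAt_sq_max (x : ℝ) :
    HasDerivAt (fun y : ℝ => (max y 0) ^ 2) (2 * max x 0) x := by
  rcases lt_trichotomy x 0 with hx | rfl | hx
  · rw [max_eq_right hx.le, mul_zero]
    refine (hasDerivAt_const x (0 : ℝ)).congr_of_eventuallyEq ?_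
    filter_upwards [gt_mem_nhds hx] with y hy
    rw [max_eq_right (le_of_lt hy)]
    norm_num
  · rw [max_self, mul_zero, hasDerivAt_iff_isLittleO]
    refine Asymptotics.isLittleO_iff.2 fun c hc => ?_
    filter_upwards [Metric.ball_mem_nhds (0 : ℝ) hc] with y hy
    rw [mem_ball_zero_iff] at hy
    simp only [max_self, smul_zero, sub_zero, ne_eq, OfNat.ofNat_ne_zero, not_false_eq_true,
      zero_pow, Real.norm_eq_abs] at hy ⊢
    rw [abs_pow, sq]
    have h1 : |max y 0| ≤ |y| := by
      rw [abs_of_nonneg (le_max_right _ _)]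
      exact max_le (le_abs_self y) (abs_nonneg y)
    exact mul_le_mul (h1.trans hy.le) h1 (abs_nonneg _) hc.le
  · rw [max_eq_left hx.le]
    have h := hasDerivAt_pow 2 x
    simp only [Nat.cast_ofNat, Nat.add_one_sub_one, pow_one] at h
    refine h.congr_of_eventuallyEq ?_
    filter_upwards [lt_mem_nhds hx] with y hy
    rw [max_eq_left (le_of_lt hy)]

/-- The force per unit area on a plate that moves with velocity `s` along its normal. -/
noncomputable def plateForce (d : ℕ) [NeZero d] (σ : ℝ → ℝ) (s : ℝ) : ℝ :=
  ∫ w : EuclideanSpace ℝ (Fin d), (max (s - w 0) 0) ^ 2 * σ ‖w‖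

/-! ### Moments of the density and the plate force -/

namespace ClassA

variable {d : ℕ} {σ : ℝ → ℝ}

theorem strictAntiOn (hσ : ClassA d σ) : StrictAntiOn σ (Ici 0) := by
  refine strictAntiOn_of_deriv_neg (convex_Ici 0) hσ.contDiffOn.continuousOn fun r hr => ?_
  rw [interior_Ici] at hr
  have hr' : (0 : ℝ) < r := hr
  have := mul_neg_of_neg_of_pos (hσ.neg r hr) hr'
  rwa [div_mul_cancel₀ _ hr'.ne'] at this

/-- If `σ` were nonpositive at `r`, it would stay below `σ (r + 1) < 0` afterwards, against
integrability. -/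
theorem pos (hσ : ClassA d σ) (hd : 3 ≤ d) {r : ℝ} (hr : 0 ≤ r) : 0 < σ r := by
  by_contra! h
  have hr1 : (0 : ℝ) < r + 1 := by linarith
  have hneg : σ (r + 1) < 0 :=
    (hσ.strictAntiOn (mem_Ici.2 hr) (mem_Ici.2 hr1.le) (lt_add_one r)).trans_le h
  have hle : ∀ x ∈ Ioi (r + 1), ‖σ (r + 1)‖ ≤ ‖x ^ 2 * σ x * (d * x ^ (d - 1))‖ := by
    intro x hx
    have hx' : r + 1 < x := hx
    have hx1 : 1 ≤ x := by linarith
    have h1 : σ x < σ (r + 1) :=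
      hσ.strictAntiOn (mem_Ici.2 hr1.le) (mem_Ici.2 (by linarith)) hx'
    have h2 : (1 : ℝ) ≤ d := by exact_mod_cast (by omega : 1 ≤ d)
    have h3 : 1 ≤ x ^ 2 * (d * x ^ (d - 1)) :=
      one_le_mul_of_one_le_of_one_le (one_le_pow₀ hx1)
        (one_le_mul_of_one_le_of_one_le h2 (one_le_pow₀ hx1))
    rw [show x ^ 2 * σ x * (d * x ^ (d - 1)) = (x ^ 2 * (d * x ^ (d - 1))) * σ x by ring,
      norm_mul, Real.norm_of_nonneg (by linarith : (0:ℝ) ≤ x ^ 2 * (d * x ^ (d - 1))),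
      Real.norm_of_nonpos hneg.le, Real.norm_of_nonpos (by linarith)]
    nlinarith
  have hI : IntegrableOn (fun _ : ℝ => σ (r + 1)) (Ioi (r + 1)) := by
    refine Integrable.mono (hσ.integrable.mono_set (Ioi_subset_Ioi hr1.le))
      aestronglyMeasurable_const ?_
    rw [ae_restrict_iff' measurableSet_Ioi]
    exact Eventually.of_forall hle
  rw [integrableOn_const_iff] at hI
  rcases hI with h0 | h0
  · exact hneg.ne (by simpa using h0)
  · simp at h0

theorem continuous_comp_norm (hσ : ClassA d σ) :
    Continuous fun w : EuclideanSpace ℝ (Fin d) => σ ‖w‖ :=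
  hσ.contDiffOn.continuousOn.comp_continuous continuous_norm fun w => norm_nonneg w

theorem abs_apply_le (w : EuclideanSpace ℝ (Fin d)) (i : Fin d) : |w i| ≤ ‖w‖ := by
  simpa using PiLp.norm_apply_le w i

variable [NeZero d]

theorem integrable_sq (hσ : ClassA d σ) :
    Integrable fun w : EuclideanSpace ℝ (Fin d) => ‖w‖ ^ 2 * σ ‖w‖ := by
  have hd0 : (d : ℝ) ≠ 0 := Nat.cast_ne_zero.2 (NeZero.ne d)
  have : Nontrivial (EuclideanSpace ℝ (Fin d)) :=
    Module.nontrivial_of_finrank_pos (R := ℝ) (by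
      rw [finrank_euclideanSpace_fin]; exact Nat.pos_of_ne_zero (NeZero.ne d))
  refine (integrable_fun_norm_addHaar (volume : Measure (EuclideanSpace ℝ (Fin d)))
    (f := fun r => r ^ 2 * σ r)).2 ?_
  rw [finrank_euclideanSpace_fin]
  refine (hσ.integrable.const_mul (1 / (d : ℝ))).congr (Eventually.of_forall fun r => ?_)
  simp only [smul_eq_mul]
  field_simp

theorem integrable_norm (hσ : ClassA d σ) (hd : 3 ≤ d) :
    Integrable fun w : EuclideanSpace ℝ (Fin d) => σ ‖w‖ := by
  have hind : Integrable ((Metric.closedBall (0 : EuclideanSpace ℝ (Fin d)) 1).indicator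
      fun _ => σ 0) :=
    (integrable_indicator_iff measurableSet_closedBall).2
      (integrableOn_const (isCompact_closedBall _ _).measure_lt_top.ne)
  refine (hσ.integrable_sq.add hind).mono' hσ.continuous_comp_norm.aestronglyMeasurable
    (Eventually.of_forall fun w => ?_)
  have hpos := hσ.pos hd (norm_nonneg w)
  rw [Real.norm_of_nonneg hpos.le, Pi.add_apply]
  by_cases hw : ‖w‖ ≤ 1
  · rw [indicator_of_mem (by simpa using hw)]
    have h1 := hσ.strictAntiOn.antitoneOn (mem_Ici.2 le_rfl) (mem_Ici.2 (norm_nonneg w))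
      (norm_nonneg w)
    have h2 : 0 ≤ ‖w‖ ^ 2 * σ ‖w‖ := by positivity
    linarith
  · rw [indicator_of_notMem (by simpa using hw), add_zero]
    have h1 : 1 ≤ ‖w‖ ^ 2 := one_le_pow₀ (not_le.1 hw).le
    nlinarith

/-- Functions of at most quadratic growth are integrable against the density. -/
theorem integrable_mul (hσ : ClassA d σ) (hd : 3 ≤ d) {φ : EuclideanSpace ℝ (Fin d) → ℝ}
    (hφ : Continuous φ) {C : ℝ} (hC : ∀ w, |φ w| ≤ C * (1 + ‖w‖ ^ 2)) :
    Integrable fun w => φ w * σ ‖w‖ := by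
  refine (((hσ.integrable_norm hd).add hσ.integrable_sq).const_mul C).mono'
    (hφ.mul hσ.continuous_comp_norm).aestronglyMeasurable (Eventually.of_forall fun w => ?_)
  have hpos := hσ.pos hd (norm_nonneg w)
  rw [norm_mul, Real.norm_eq_abs, Real.norm_of_nonneg hpos.le]
  refine (mul_le_mul_of_nonneg_right (hC w) hpos.le).trans (le_of_eq ?_)
  simp only [Pi.add_apply]
  ring

theorem continuous_max_sub (s : ℝ) :
    Continuous fun w : EuclideanSpace ℝ (Fin d) => max (s - w 0) 0 := by
  fun_prop

theorem max_sub_le (s : ℝ) (w : EuclideanSpace ℝ (Fin d)) :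
    max (s - w 0) 0 ≤ |s| + ‖w‖ :=
  max_le (by linarith [le_abs_self s, neg_abs_le (w 0), abs_apply_le w 0])
    (by positivity)

theorem integrable_plateForce (hσ : ClassA d σ) (hd : 3 ≤ d) (s : ℝ) :
    Integrable fun w : EuclideanSpace ℝ (Fin d) => (max (s - w 0) 0) ^ 2 * σ ‖w‖ := by
  refine hσ.integrable_mul hd ((continuous_max_sub s).pow 2) (C := 2 * (1 + s ^ 2)) fun w => ?_
  rw [abs_of_nonneg (by positivity)]
  have h1 := pow_le_pow_left₀ (le_max_right _ _) (max_sub_le s w) 2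
  nlinarith [sq_nonneg (|s| - ‖w‖), sq_abs s, mul_nonneg (sq_nonneg s) (sq_nonneg ‖w‖)]

theorem integrable_plateForce_deriv (hσ : ClassA d σ) (hd : 3 ≤ d) (s : ℝ) :
    Integrable fun w : EuclideanSpace ℝ (Fin d) => (2 * max (s - w 0) 0) * σ ‖w‖ := by
  refine hσ.integrable_mul hd (continuous_const.mul (continuous_max_sub s))
    (C := 2 * (|s| + 1)) fun w => ?_
  rw [abs_of_nonneg (by positivity)]
  nlinarith [max_sub_le s w, sq_nonneg (‖w‖ - 1), abs_nonneg s, sq_nonneg ‖w‖,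
    mul_nonneg (abs_nonneg s) (sq_nonneg ‖w‖)]

theorem hasDerivAt_plateForce (hσ : ClassA d σ) (hd : 3 ≤ d) (s : ℝ) :
    HasDerivAt (plateForce d σ)
      (∫ w : EuclideanSpace ℝ (Fin d), (2 * max (s - w 0) 0) * σ ‖w‖) s := by
  refine (hasDerivAt_integral_of_dominated_loc_of_deriv_le
    (F := fun s (w : EuclideanSpace ℝ (Fin d)) => (max (s - w 0) 0) ^ 2 * σ ‖w‖)
    (F' := fun s (w : EuclideanSpace ℝ (Fin d)) => (2 * max (s - w 0) 0) * σ ‖w‖)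
    -- The derivative of the integrand increases with `s`, so its value at `s + 1` dominates on the
    -- unit ball around `s`.
    (bound := fun w => (2 * max ((s + 1) - w 0) 0) * σ ‖w‖)
    (Metric.ball_mem_nhds s one_pos)
    (Eventually.of_forall fun x => (hσ.integrable_plateForce hd x).aestronglyMeasurable)
    (hσ.integrable_plateForce hd s) (hσ.integrable_plateForce_deriv hd s).aestronglyMeasurable
    (Eventually.of_forall fun w x hx => ?_) (hσ.integrable_plateForce_deriv hd (s + 1))
    (Eventually.of_forall fun w x _ => ?_)).2
  · have hpos := hσ.pos hd (norm_nonneg w)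
    rw [Real.norm_of_nonneg (by positivity)]
    have hx' : x ≤ s + 1 := by
      rw [Metric.mem_ball, Real.dist_eq] at hx
      linarith [(abs_lt.1 hx).2]
    gcongr
  · have h := ((hasDerivAt_sq_max (x - w 0)).comp x ((hasDerivAt_id x).sub_const (w 0)))
    rw [mul_one] at h
    exact h.mul_const _

theorem strictMono_plateForce (hσ : ClassA d σ) (hd : 3 ≤ d) : StrictMono (plateForce d σ) := by
  refine strictMono_of_deriv_pos fun s => ?_
  rw [(hσ.hasDerivAt_plateForce hd s).deriv]
  have hc : Continuous fun w : EuclideanSpace ℝ (Fin d) => (2 * max (s - w 0) 0) * σ ‖w‖ :=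
    (continuous_const.mul (continuous_max_sub s)).mul hσ.continuous_comp_norm
  refine (integral_pos_iff_support_of_nonneg (fun w => ?_)
    (hσ.integrable_plateForce_deriv hd s)).2 ?_
  · have hpos := hσ.pos hd (norm_nonneg w)
    simp only [Pi.zero_apply]
    positivity
  · refine hc.isOpen_support.measure_pos _ ⟨EuclideanSpace.single 0 (s - 1), ?_⟩
    have hpos := hσ.pos hd (norm_nonneg (EuclideanSpace.single (0 : Fin d) (s - 1)))
    rw [Function.mem_support]
    refine mul_ne_zero ?_ hpos.ne'
    simp

/-- The total mass of the density. -/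
noncomputable def mass (d : ℕ) (σ : ℝ → ℝ) : ℝ := ∫ w : EuclideanSpace ℝ (Fin d), σ ‖w‖

theorem mass_pos (hσ : ClassA d σ) (hd : 3 ≤ d) : 0 < mass d σ := by
  refine (integral_pos_iff_support_of_nonneg (fun w => (hσ.pos hd (norm_nonneg w)).le)
    (hσ.integrable_norm hd)).2 ?_
  exact hσ.continuous_comp_norm.isOpen_support.measure_pos _
    ⟨0, (hσ.pos hd (norm_nonneg _)).ne'⟩

/-- The reflection `w ↦ -w` turns the sum into the integral of `(s - w 0) ^ 2`, whose cross term is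
odd. -/
theorem plateForce_add_neg (hσ : ClassA d σ) (hd : 3 ≤ d) (s : ℝ) :
    plateForce d σ s + plateForce d σ (-s) =
      (∫ w : EuclideanSpace ℝ (Fin d), (w 0) ^ 2 * σ ‖w‖) + s ^ 2 * mass d σ := by
  have hodd : ∫ w : EuclideanSpace ℝ (Fin d), w 0 * σ ‖w‖ = 0 := by
    have h := integral_neg_eq_self (fun w : EuclideanSpace ℝ (Fin d) => w 0 * σ ‖w‖) volume
    simp only [PiLp.neg_apply, norm_neg, neg_mul, integral_neg] at h
    linarith
  have hneg : plateForce d σ (-s) =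
      ∫ w : EuclideanSpace ℝ (Fin d), (max (w 0 - s) 0) ^ 2 * σ ‖w‖ := by
    rw [plateForce, ← integral_neg_eq_self]
    congr 1
    funext w
    rw [norm_neg, PiLp.neg_apply]
    congr 3
    ring
  have hI := hσ.integrable_plateForce hd s
  have hI' : Integrable fun w : EuclideanSpace ℝ (Fin d) => (max (w 0 - s) 0) ^ 2 * σ ‖w‖ := by
    have := (hσ.integrable_plateForce hd (-s)).comp_neg
    refine this.congr (Eventually.of_forall fun w => ?_)
    simp only [PiLp.neg_apply, norm_neg]
    congr 3
    ring
  have h0 : Integrable fun w : EuclideanSpace ℝ (Fin d) => (w 0) ^ 2 * σ ‖w‖ :=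
    hσ.integrable_mul hd (by fun_prop) (C := 1) fun w => by
      rw [abs_of_nonneg (by positivity), ← sq_abs]
      have := pow_le_pow_left₀ (abs_nonneg _) (abs_apply_le w 0) 2
      linarith
  have h1 : Integrable fun w : EuclideanSpace ℝ (Fin d) => w 0 * σ ‖w‖ :=
    hσ.integrable_mul hd (by fun_prop) (C := 1) fun w => by
      nlinarith [abs_apply_le w 0, sq_nonneg (‖w‖ - 1)]
  rw [hneg, plateForce, ← integral_add hI hI']
  have hpt : (fun w : EuclideanSpace ℝ (Fin d) =>
      (max (s - w 0) 0) ^ 2 * σ ‖w‖ + (max (w 0 - s) 0) ^ 2 * σ ‖w‖)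
      = fun w => ((w 0) ^ 2 * σ ‖w‖ + s ^ 2 * σ ‖w‖) - (2 * s) * (w 0 * σ ‖w‖) := by
    funext w
    rcases le_total s (w 0) with h | h
    · rw [max_eq_right (sub_nonpos.2 h), max_eq_left (sub_nonneg.2 h)]
      ring
    · rw [max_eq_left (sub_nonneg.2 h), max_eq_right (sub_nonpos.2 h)]
      ring
  have h2 := (hσ.integrable_norm hd).const_mul (s ^ 2)
  have h3 : Integrable fun w : EuclideanSpace ℝ (Fin d) => (w 0) ^ 2 * σ ‖w‖ + s ^ 2 * σ ‖w‖ :=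
    h0.add h2
  rw [hpt, integral_sub h3 (h1.const_mul _), integral_add h0 h2, integral_const_mul,
    integral_const_mul, hodd, mass]
  ring

end ClassA

theorem axis_ne_zero {d : ℕ} [NeZero d] (hd : 3 ≤ d) : (0 : Fin d) ≠ axis d := by
  intro h
  have := congrArg Fin.val h
  simp [axis, Fin.val_rev] at this
  omega

/-- The density being invariant under rotations, the integral of a function of `⟪n, w⟫` and `‖w‖`
does not depend on the unit vector `n`. -/
theorem integral_inner_eq {E : Type*} [NormedAddCommGroup E] [InnerProductSpace ℝ E]
    [FiniteDimensional ℝ E] [MeasurableSpace E] [BorelSpace E] (φ : ℝ → ℝ → ℝ) {m n : E}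
    (h : ‖n‖ = ‖m‖) :
    ∫ w : E, φ (inner ℝ n w) ‖w‖ = ∫ w : E, φ (inner ℝ m w) ‖w‖ := by
  have hr : (ℝ ∙ (n - m))ᗮ.reflection n = m := Submodule.reflection_sub h
  have hmp := ((ℝ ∙ (n - m))ᗮ.reflection).measurePreserving
  rw [← hmp.integral_comp ((ℝ ∙ (n - m))ᗮ.reflection).toHomeomorph.measurableEmbedding]
  congr 1
  funext w
  rw [LinearIsometryEquiv.norm_map]
  congr 1
  rw [← LinearIsometryEquiv.inner_map_map ((ℝ ∙ (n - m))ᗮ.reflection) n, hr,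
    Submodule.reflection_reflection]

/-- Translation by `V e_d` centres the density. The integrand then depends only on the velocity
component along the unit vector `n`, which rotational invariance replaces by a coordinate vector. -/
theorem pressure_eq {d : ℕ} [NeZero d] (hd : 3 ≤ d) (σ : ℝ → ℝ) (V : ℝ) {ε : ℝ} (hε : ε ^ 2 = 1)
    (u : ℝ) : pressure d σ V ε u = ε * plateForce d σ (ε * V / √(1 + u ^ 2)) := by
  have hne := axis_ne_zero hd
  have hr2 : √(1 + u ^ 2) ^ 2 = 1 + u ^ 2 := Real.sq_sqrt (by positivity)
  set r := √(1 + u ^ 2) with hr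
  have hr0 : 0 < r := Real.sqrt_pos.2 (by positivity)
  set n : EuclideanSpace ℝ (Fin d) :=
    EuclideanSpace.single 0 (u / r) + EuclideanSpace.single (axis d) (ε / r) with hn
  have hinner : ∀ w : EuclideanSpace ℝ (Fin d), inner ℝ n w = (u * w 0 + ε * w (axis d)) / r := by
    intro w
    rw [hn, inner_add_left, EuclideanSpace.inner_single_left, EuclideanSpace.inner_single_left]
    simp only [conj_trivial]
    ring
  have hnorm : ‖n‖ = ‖(EuclideanSpace.single 0 1 : EuclideanSpace ℝ (Fin d))‖ := by
    have h1 : ‖n‖ ^ 2 = 1 := by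
      rw [← real_inner_self_eq_norm_sq, hinner, hn]
      simp only [PiLp.add_apply, PiLp.single_apply, hne, hne.symm, if_true, if_false]
      rw [zero_add, add_zero]
      have : (u * (u / r) + ε * (ε / r)) / r = (u ^ 2 + ε ^ 2) / r ^ 2 := by field_simp
      rw [this, hε, hr2, add_comm, div_self (by positivity)]
    rw [PiLp.norm_single, norm_one]
    exact (pow_eq_one_iff_of_nonneg (norm_nonneg _) two_ne_zero).1 h1
  rw [pressure, plateForce]
  congr 1
  have hφ := integral_inner_eq (fun x y => (max (ε * V / r - x) 0) ^ 2 * σ y) hnorm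
  simp only [EuclideanSpace.inner_single_left, conj_trivial, one_mul] at hφ
  rw [← hφ]
  conv_rhs => rw [← integral_add_right_eq_self _
    (V • EuclideanSpace.single (axis d) (1 : ℝ) : EuclideanSpace ℝ (Fin d))]
  congr 1
  funext v
  rw [density, hinner]
  congr 1
  simp only [PiLp.add_apply, PiLp.smul_apply, PiLp.single_apply, hne, if_true, if_false,
    smul_eq_mul, mul_zero, add_zero, mul_one]
  have h1 : ε * V / r - (u * v 0 + ε * (v (axis d) + V)) / r
      = -(v 0 * u + ε * v (axis d)) / r := by
    field_simp
    ring
  rw [h1, ← hr2, ← div_pow, ← max_div_div_right hr0.le, zero_div]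

/-- For either sign, `s ↦ ε * G(ε * s)` is strictly increasing, where `G` is the plate force. Its
argument `V / √(1 + u²)` is positive, at most `V`, and tends to `0`. -/
theorem ClassA.isPressure_pressure {d : ℕ} [NeZero d] {σ : ℝ → ℝ} (hσ : ClassA d σ) (hd : 3 ≤ d)
    {V : ℝ} (hV : 0 < V) {ε : ℝ} (hε : ε = 1 ∨ ε = -1) : IsPressure (pressure d σ V ε) := by
  have hε2 : ε ^ 2 = 1 := by rcases hε with rfl | rfl <;> norm_num
  have heq : pressure d σ V ε = fun u => ε * plateForce d σ (ε * V / √(1 + u ^ 2)) :=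
    funext (pressure_eq hd σ V hε2)
  have hmono := hσ.strictMono_plateForce hd
  have hG : Differentiable ℝ (plateForce d σ) := fun s =>
    (hσ.hasDerivAt_plateForce hd s).differentiableAt
  have hsq : ∀ u : ℝ, 0 < √(1 + u ^ 2) := fun u => Real.sqrt_pos.2 (by positivity)
  rw [heq]
  refine ⟨?_, ⟨max |plateForce d σ (-V)| |plateForce d σ V|, fun u => ?_⟩,
    ε * plateForce d σ 0, fun u _ => ?_, ?_⟩
  · intro u
    have h1 : DifferentiableAt ℝ (fun u : ℝ => √(1 + u ^ 2)) u :=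
      DifferentiableAt.sqrt (by fun_prop) (by positivity)
    exact ((hG _).comp u (DifferentiableAt.div (differentiableAt_const _) h1
      (hsq u).ne')).const_mul ε
  · have habs : |ε| = 1 := by rcases hε with rfl | rfl <;> simp
    have hle : |ε * V / √(1 + u ^ 2)| ≤ V := by
      rw [abs_div, abs_mul, habs, one_mul, abs_of_pos hV, abs_of_pos (hsq u)]
      exact div_le_self hV.le (Real.one_le_sqrt.2 (by linarith [sq_nonneg u]))
    rw [abs_mul, habs, one_mul]
    exact abs_le_max_abs_abs (hmono.monotone (abs_le.1 hle).1) (hmono.monotone (abs_le.1 hle).2)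
  · have h0 : 0 < V / √(1 + u ^ 2) := div_pos hV (hsq u)
    rcases hε with rfl | rfl
    · rw [one_mul, one_mul, one_mul]
      exact hmono h0
    · rw [neg_one_mul, neg_one_mul, neg_one_mul, neg_div]
      exact neg_lt_neg (hmono (neg_lt_zero.2 h0))
  · have h1 : Tendsto (fun u : ℝ => √(1 + u ^ 2)) atTop atTop := by
      refine tendsto_atTop_mono (fun u => ?_) tendsto_id
      exact Real.le_sqrt_of_sq_le (by simp)
    exact ((hG.continuous.tendsto 0).comp (h1.const_div_atTop (ε * V))).const_mul ε

theorem ClassA.isPressure_pFront {d : ℕ} [NeZero d] {σ : ℝ → ℝ} (hσ : ClassA d σ) (hd : 3 ≤ d)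
    {V : ℝ} (hV : 0 < V) : IsPressure (pFront d σ V) :=
  hσ.isPressure_pressure hd hV (Or.inl rfl)

theorem ClassA.isPressure_pRear {d : ℕ} [NeZero d] {σ : ℝ → ℝ} (hσ : ClassA d σ) (hd : 3 ≤ d)
    {V : ℝ} (hV : 0 < V) : IsPressure (pRear d σ V) :=
  hσ.isPressure_pressure hd hV (Or.inr rfl)

theorem ClassA.pFront_sub_pRear {d : ℕ} [NeZero d] {σ : ℝ → ℝ} (hσ : ClassA d σ) (hd : 3 ≤ d)
    (V u : ℝ) : pFront d σ V u - pRear d σ V u =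
      (∫ w : EuclideanSpace ℝ (Fin d), (w 0) ^ 2 * σ ‖w‖) + V ^ 2 * ClassA.mass d σ / (1 + u ^ 2) := by
  rw [pFront, pRear, pressure_eq hd σ V (by norm_num), pressure_eq hd σ V (by norm_num)]
  have h := hσ.plateForce_add_neg hd (V / √(1 + u ^ 2))
  rw [div_pow, Real.sq_sqrt (by positivity)] at h
  rw [neg_one_mul, neg_one_mul, one_mul, one_mul, neg_div, sub_neg_eq_add, h]
  ring

theorem pressure_neg {d : ℕ} [NeZero d] (hd : 3 ≤ d) (σ : ℝ → ℝ) (V : ℝ) {ε : ℝ}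
    (hε : ε ^ 2 = 1) (u : ℝ) : pressure d σ V ε (-u) = pressure d σ V ε u := by
  rw [pressure_eq hd σ V hε, pressure_eq hd σ V hε, neg_sq]

/-! ### Comparison of initial slopes; resistance of Newton profiles -/

namespace IsPressure

variable {p p' : ℝ → ℝ} {d : ℕ}

theorem le_convEnvDeriv_zero (hp : IsPressure p) {S : ℝ} (h : ∀ u, 0 ≤ u → p 0 - S * u ≤ p u) :
    -S ≤ convEnvDeriv p 0 := by
  have ht := hasDerivWithinAt_iff_tendsto_slope.1 (hp.hasDerivWithinAt_convEnv le_rfl)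
  rw [Ici_sdiff_left] at ht
  refine ge_of_tendsto ht ?_
  filter_upwards [self_mem_nhdsWithin] with w hw
  have hw' : (0 : ℝ) < w := hw
  rw [slope_def_field, le_div_iff₀ (by linarith), hp.convEnv_zero]
  have := affine_le_convEnv (p := p) (c := p 0) (s := -S)
    (fun v hv => by linarith [h v hv]) hw'.le
  linarith

/-- An additional term `k / (1 + u ^ 2)` makes the initial slope of the convex envelope
steeper. -/
theorem convEnvDeriv_zero_lt (hp : IsPressure p) (hp' : IsPressure p')
    (heven : ∀ u, p' (-u) = p' u) {c k : ℝ} (hk : 0 < k)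
    (h : ∀ u, p u - p' u = c + k / (1 + u ^ 2)) :
    convEnvDeriv p 0 < convEnvDeriv p' 0 := by
  by_contra! hle
  obtain ⟨M, hM⟩ := hp'.bounded
  have hM0 : 0 ≤ M := (abs_nonneg _).trans (hM 0)
  set S := -convEnvDeriv p' 0 with hS
  have hS0 : 0 < S := neg_pos.2 (hp'.convEnvDeriv_neg le_rfl)
  -- If the envelope of `p` were not steeper, its initial supporting line would pass to `p'` with a
  -- surplus `k * u² / (1 + u²)`.
  have hlow : ∀ u, 0 ≤ u → p' 0 - S * u + k * (u ^ 2 / (1 + u ^ 2)) ≤ p' u := by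
    intro u hu
    have h1 := (hp.support_le_convEnv le_rfl hu).trans (hp.convEnv_le hu)
    rw [hp.convEnv_zero, sub_zero] at h1
    have h2 := mul_le_mul_of_nonneg_right hle hu
    have h3 := h 0
    have h4 := h u
    have h5 : k / (1 + u ^ 2) = k - k * (u ^ 2 / (1 + u ^ 2)) := by
      field_simp
      ring
    norm_num at h3
    linarith
  have hd0 : deriv p' 0 = 0 := by
    have h1 := deriv_comp_neg p' 0
    rw [funext heven, neg_zero] at h1
    linarith
  have hd := (hasDerivAt_iff_isLittleO.1 (hp'.differentiable 0).hasDerivAt).def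
    (half_pos hS0)
  rw [hd0] at hd
  obtain ⟨δ, hδ, hball⟩ := Metric.eventually_nhds_iff.1 hd
  set R := 4 * M / S + 1 with hR
  have hR0 : 0 < R := by positivity
  set e := k * (δ ^ 2 / (1 + δ ^ 2)) with he
  have he0 : 0 < e := by positivity
  -- The slope `S` can then be strictly reduced: near `0` because the even function `p'` has zero
  -- derivative there, on `[δ, R]` by the surplus `e`, and beyond `R` by boundedness. This
  -- contradicts the definition of `S`.
  have hS' : ∀ u, 0 ≤ u → p' 0 - max (S / 2) (S - e / R) * u ≤ p' u := by
    intro u hu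
    have hm1 := mul_le_mul_of_nonneg_right (le_max_left (S / 2) (S - e / R)) hu
    have hm2 := mul_le_mul_of_nonneg_right (le_max_right (S / 2) (S - e / R)) hu
    rcases lt_or_ge u δ with hu1 | hu1
    · have := hball (y := u) (by rw [Real.dist_eq, sub_zero, abs_of_nonneg hu]; exact hu1)
      simp only [sub_zero, smul_eq_mul, mul_zero, Real.norm_eq_abs, abs_of_nonneg hu] at this
      linarith [(abs_le.1 this).1]
    · rcases le_or_gt u R with hu2 | hu2
      · have h1 := hlow u hu
        have h2 : e ≤ k * (u ^ 2 / (1 + u ^ 2)) := by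
          refine mul_le_mul_of_nonneg_left ?_ hk.le
          rw [div_le_div_iff₀ (by positivity) (by positivity)]
          nlinarith [pow_le_pow_left₀ hδ.le hu1 2]
        have h3 : e / R * u ≤ e := by
          rw [div_mul_eq_mul_div, div_le_iff₀ hR0]
          exact mul_le_mul_of_nonneg_left hu2 he0.le
        linarith
      · have h1 : 4 * M ≤ S * u := by
          have h2 : 4 * M / S ≤ u := by linarith
          rw [div_le_iff₀ hS0] at h2
          linarith
        linarith [(abs_le.1 (hM u)).1, (abs_le.1 (hM 0)).2]
  have hfin := hp'.le_convEnvDeriv_zero hS'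
  have hlt : max (S / 2) (S - e / R) < S :=
    max_lt (by linarith) (by linarith [div_pos he0 hR0])
  linarith

theorem newtonProfile_ac (hp : IsPressure p) (hd : 3 ≤ d) {U : ℝ} (hU : 0 ≤ U) :
    AbsolutelyContinuousOnInterval (newtonProfile d p U) 0 1 := by
  have := hp.lipschitzOnWith_newtonProfile hd hU
  rw [← uIcc_of_le (zero_le_one' ℝ)] at this
  exact this.absolutelyContinuousOnInterval

/-- The minimum of `p w + μ w` for the slope `-μ` of the convex envelope at `U`. -/
theorem isLeast_convEnv (hp : IsPressure p) {U : ℝ} (hU : 0 ≤ U) :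
    IsLeast ((fun w => p w + -convEnvDeriv p U * w) '' Ici 0)
      (convEnv p U + -convEnvDeriv p U * U) := by
  obtain ⟨w₀, hw₀, heq, hmin⟩ := hp.exists_min_convEnv (neg_pos.2 (hp.convEnvDeriv_neg hU))
  refine ⟨⟨w₀, hw₀, ?_⟩, ?_⟩
  · have h1 := hp.support_le_convEnv hU hw₀
    have h2 := hmin U hU
    simp only
    linarith
  · rintro _ ⟨w, hw, rfl⟩
    have hw0 : (0 : ℝ) ≤ w := hw
    have h1 := (hp.support_le_convEnv hU hw0).trans (hp.convEnv_le hw0)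
    simp only
    linarith

/-- The value is `p̄(U) + μ * U - μ * h(U) = p̄(U) + μ * Q(U) / q(U)` with `μ = 1 / q(U) ^ (d - 2)`.
-/
theorem partResistance_newtonProfile (hp : IsPressure p) (hd : 3 ≤ d) {U : ℝ} (hU : 0 ≤ U) :
    partResistance d p (newtonProfile d p U) =
      convEnv p U + QFun d p U / qFun d p U ^ (d - 1) := by
  rw [hp.partResistance_eq hd (neg_pos.2 (hp.convEnvDeriv_neg hU))
    (hp.isProfile_newtonProfile hd hU) (hp.newtonProfile_one hd hU) (hp.newtonProfile_ac hd hU)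
    (hp.minimizesSlopes_newtonProfile hd hU) (hp.isLeast_convEnv hU), hFun]
  have hq := hp.qFun_pos (d := d) hU
  have h1 := hp.neg_convEnvDeriv_mul_qFun_pow hd hU
  have h2 : qFun d p U ^ (d - 1) = qFun d p U ^ (d - 2) * qFun d p U := by
    rw [← pow_succ]
    congr 1
    omega
  have h3 : -convEnvDeriv p U = 1 / qFun d p U ^ (d - 2) :=
    eq_one_div_of_mul_eq_one_left h1
  rw [h2, h3]
  field_simp
  ring

theorem isProfile_zero : IsProfile 0 (fun _ => 0) where
  convexOn := convexOn_const 0 (convex_Icc 0 1)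
  nonpos := fun _ _ => le_rfl
  monotoneOn := monotoneOn_const
  continuousOn := continuousOn_const
  apply_zero := neg_zero.symm

theorem ac_zero : AbsolutelyContinuousOnInterval (fun _ : ℝ => (0 : ℝ)) 0 1 :=
  ((LipschitzWith.const (0 : ℝ)).lipschitzOnWith (K := 0)).absolutelyContinuousOnInterval

theorem partResistance_zero (hp : IsPressure p) (hd : 3 ≤ d) :
    partResistance d p (fun _ => 0) = convEnv p 0 := by
  have h0 := hp.convEnvDeriv_neg (le_refl (0 : ℝ))
  rw [hp.partResistance_eq hd (neg_pos.2 h0) isProfile_zero rfl ac_zero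
    (hp.minimizesSlopes_zero hd le_rfl) (hp.isLeast_convEnv le_rfl)]
  ring

end IsPressure

/-! ### The two-part problem -/

section TwoParts

variable {d : ℕ} [NeZero d] {σ : ℝ → ℝ} {V : ℝ} {hp hm μ : ℝ} {fp fm : ℝ → ℝ}

/-- Two profiles whose slopes minimize with a common multiplier are the unique solution. -/
theorem isUniqueOptimal_of_minimizesSlopes (hσ : ClassA d σ) (hd : 3 ≤ d) (hV : 0 < V)
    (hμ : 0 < μ) (hfp : IsProfile hp fp) (hfm : IsProfile hm fm) (hfp1 : fp 1 = 0)
    (hfm1 : fm 1 = 0) (hfpac : AbsolutelyContinuousOnInterval fp 0 1)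
    (hfmac : AbsolutelyContinuousOnInterval fm 0 1)
    (hminp : MinimizesSlopes d (pFront d σ V) μ fp)
    (hminm : MinimizesSlopes d (pRear d σ V) μ fm) :
    IsUniqueOptimal d σ V (hp + hm) fp fm := by
  have hadm : Admissible (hp + hm) fp fm := ⟨hp, hm, hfp, hfm, rfl⟩
  have keyp := fun z g => (hσ.isPressure_pFront hd hV).penalized_le hd hμ hfp hfp1 hfpac hminp
    (z := z) (g := g)
  have keym := fun z g => (hσ.isPressure_pRear hd hV).penalized_le hd hμ hfm hfm1 hfmac hminm
    (z := z) (g := g)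
  have hopt : ∀ gp gm : ℝ → ℝ, Admissible (hp + hm) gp gm →
      resistance d σ V fp fm ≤ resistance d σ V gp gm := by
    rintro gp gm ⟨zp, zm, hgp, hgm, hz⟩
    have h1 := (keyp zp gp hgp).1
    have h2 := (keym zm gm hgm).1
    -- The penalties cancel, because the multiplier is common and the total lengths agree.
    have h3 : μ * ((d : ℝ) - 1) * zp + μ * ((d : ℝ) - 1) * zm
        = μ * ((d : ℝ) - 1) * hp + μ * ((d : ℝ) - 1) * hm := by
      rw [← mul_add, hz, mul_add]
    simp only [resistance]
    linarith
  refine ⟨⟨hadm, hopt⟩, ?_⟩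
  rintro gp gm ⟨⟨zp, zm, hgp, hgm, hz⟩, hgopt⟩
  have h0 := hgopt fp fm hadm
  have h1 := keyp zp gp hgp
  have h2 := keym zm gm hgm
  have h3 : μ * ((d : ℝ) - 1) * zp + μ * ((d : ℝ) - 1) * zm
      = μ * ((d : ℝ) - 1) * hp + μ * ((d : ℝ) - 1) * hm := by
    rw [← mul_add, hz, mul_add]
  simp only [resistance] at h0
  exact ⟨h1.2 (by linarith [h2.1]), h2.2 (by linarith [h1.1])⟩

theorem IsUniqueOptimal.isLeast {h : ℝ} (hopt : IsUniqueOptimal d σ V h fp fm) :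
    IsLeast (resistanceValues d σ V h) (resistance d σ V fp fm) := by
  refine ⟨⟨fp, fm, hopt.1.1, rfl⟩, ?_⟩
  rintro _ ⟨gp, gm, hg, rfl⟩
  exact hopt.1.2 gp gm hg

theorem axisFlip_apply_axis (x : EuclideanSpace ℝ (Fin d)) :
    axisFlip d x (axis d) = -x (axis d) := by
  simp [axisFlip]
  ring

theorem axisDist_axisFlip (x : EuclideanSpace ℝ (Fin d)) :
    axisDist d (axisFlip d x) = axisDist d x := by
  rw [axisDist, axisFlip_apply_axis, axisFlip, axisDist]
  congr 1
  rw [sub_sub, ← add_smul]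
  congr 2
  ring

theorem axisFlip_axisFlip (x : EuclideanSpace ℝ (Fin d)) : axisFlip d (axisFlip d x) = x := by
  rw [axisFlip, axisFlip_apply_axis, axisFlip, sub_sub, ← add_smul]
  simp

theorem body_eq_union (hfp : ∀ t ∈ Icc (0 : ℝ) 1, fp t ≤ 0) (hfm : ∀ t ∈ Icc (0 : ℝ) 1, fm t ≤ 0) :
    body d fp fm = body d fp (fun _ => 0) ∪ axisFlip d '' body d fm (fun _ => 0) := by
  ext x
  constructor
  · rintro ⟨h1, h2, h3⟩
    rcases le_total 0 (x (axis d)) with h | h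
    · exact Or.inl ⟨h1, h, h3⟩
    · refine Or.inr ⟨axisFlip d x, ⟨?_, ?_, ?_⟩, axisFlip_axisFlip x⟩
      · rwa [axisDist_axisFlip]
      · rw [axisFlip_apply_axis]
        linarith
      · rw [axisFlip_apply_axis, axisDist_axisFlip]
        linarith
  · rintro (⟨h1, h2, h3⟩ | ⟨y, ⟨h1, h2, h3⟩, rfl⟩)
    · exact ⟨h1, (hfm _ ⟨norm_nonneg _, h1⟩).trans h2, h3⟩
    · have h4 := hfp _ ⟨norm_nonneg _, h1⟩
      refine ⟨?_, ?_, ?_⟩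
      · rwa [axisDist_axisFlip]
      · rw [axisDist_axisFlip, axisFlip_apply_axis]
        linarith
      · rw [axisDist_axisFlip, axisFlip_apply_axis]
        unfold axisDist at h4 ⊢
        linarith

end TwoParts

/-! ### The height system and the two kinds of solutions -/

variable {d : ℕ} [NeZero d] {σ : ℝ → ℝ} {V : ℝ}

theorem ClassA.convEnvDeriv_zero_lt (hσ : ClassA d σ) (hd : 3 ≤ d) (hV : 0 < V) :
    convEnvDeriv (pFront d σ V) 0 < convEnvDeriv (pRear d σ V) 0 :=
  (hσ.isPressure_pFront hd hV).convEnvDeriv_zero_lt (hσ.isPressure_pRear hd hV)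
    (pressure_neg hd σ V (by norm_num))
    (mul_pos (pow_pos hV 2) (hσ.mass_pos hd)) (hσ.pFront_sub_pRear hd V)

/-- Existence of the solution of the system for the heights. -/
theorem exists_splitSystem (hσ : ClassA d σ) (hd : 3 ≤ d) (hV : 0 < V) {us h : ℝ} (hus : 0 ≤ us)
    (hslope : convEnvDeriv (pFront d σ V) us = convEnvDeriv (pRear d σ V) 0)
    (hh : hFun d (pFront d σ V) us < h) :
    ∃ hp hm up um, SplitSystem d σ V h hp hm up um := by
  have hF := hσ.isPressure_pFront hd hV
  have hR := hσ.isPressure_pRear hd hV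
  have hlt := hσ.convEnvDeriv_zero_lt hd hV
  have hq0 := hR.qFun_pos (d := d) le_rfl
  have hqs : qFun d (pFront d σ V) us = qFun d (pRear d σ V) 0 :=
    (hF.qFun_eq_qFun hR hd hus le_rfl).2 hslope
  have hq0lt : qFun d (pFront d σ V) 0 < qFun d (pRear d σ V) 0 :=
    (hF.qFun_lt_qFun hR hd le_rfl le_rfl).2 hlt
  have hh0 : 0 < h := (hF.hFun_nonneg hd hus).trans_lt hh
  have hQ := hF.QFun_nonneg (d := d) (u := h + 1) (by linarith)
  -- The unknown is the common value `κ = 1 / q_+(u_+) = 1 / q_-(u_-)`. At `κs` the total height is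
  -- `h_* < h`. At `κ₀` the test value `w = h + 1` costs at most `1`, so the front alone reaches
  -- `h`.
  set κs := 1 / qFun d (pRear d σ V) 0 with hκs
  have hκs0 : 0 < κs := one_div_pos.2 hq0
  set κ₀ := min κs (1 / (QFun d (pFront d σ V) (h + 1) + 1)) with hκ₀
  have hκ₀0 : 0 < κ₀ := lt_min hκs0 (by positivity)
  have hcont : ContinuousOn (fun κ => IsPressure.heightOf d (pFront d σ V) κ +
      IsPressure.heightOf d (pRear d σ V) κ) (Icc κ₀ κs) :=
    ((hF.continuousOn_heightOf hd).add (hR.continuousOn_heightOf hd)).mono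
      fun κ hκ => hκ₀0.trans_le hκ.1
  have hend : IsPressure.heightOf d (pFront d σ V) κs + IsPressure.heightOf d (pRear d σ V) κs
      ≤ h := by
    rw [hκs, hR.heightOf_eq_hFun hd le_rfl, ← hqs, hF.heightOf_eq_hFun hd hus,
      IsPressure.hFun_zero]
    linarith
  have hstart : h ≤ IsPressure.heightOf d (pFront d σ V) κ₀ +
      IsPressure.heightOf d (pRear d σ V) κ₀ := by
    have h1 := hF.le_heightOf hd hκ₀0 (w := h + 1) (by linarith)
    have h2 := hR.le_heightOf hd hκ₀0 (le_refl (0 : ℝ))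
    rw [IsPressure.QFun_zero, mul_zero, sub_zero] at h2
    have h3 : κ₀ * QFun d (pFront d σ V) (h + 1) ≤ 1 := by
      have h4 := mul_le_mul_of_nonneg_right (min_le_right κs
        (1 / (QFun d (pFront d σ V) (h + 1) + 1))) hQ
      refine h4.trans ?_
      rw [one_div_mul_eq_div]
      exact div_le_one_of_le₀ (by linarith) (by linarith)
    linarith
  obtain ⟨κ, hκ, hκh⟩ := intermediate_value_Icc' (min_le_left _ _) hcont ⟨hend, hstart⟩
  have hκ0 : 0 < κ := hκ₀0.trans_le hκ.1
  have hy : qFun d (pRear d σ V) 0 ≤ 1 / κ := by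
    rw [le_one_div hq0 hκ0]
    exact hκ.2
  obtain ⟨up, hup, hqup⟩ := hF.exists_qFun_eq hd (hq0lt.le.trans hy)
  obtain ⟨um, hum, hqum⟩ := hR.exists_qFun_eq hd hy
  refine ⟨hFun d (pFront d σ V) up, hFun d (pRear d σ V) um, up, um, hup, hum, rfl, rfl, ?_, ?_⟩
  · rw [← hκh]
    simp only
    rw [← hF.heightOf_eq_hFun hd hup, ← hR.heightOf_eq_hFun hd hum, hqup, hqum, one_div_one_div]
  · rw [← hF.qFun_eq_qFun hR hd hup hum, hqup, hqum]

/-- Both heights increase strictly with the common value of `q`, so the total length determines that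
value and hence both heights, though not `u_±`. -/
theorem SplitSystem.heights_unique (hσ : ClassA d σ) (hd : 3 ≤ d) (hV : 0 < V)
    {h hp hm up um hp' hm' up' um' : ℝ} (hs : SplitSystem d σ V h hp hm up um)
    (hs' : SplitSystem d σ V h hp' hm' up' um') : hp = hp' ∧ hm = hm' := by
  have hF := hσ.isPressure_pFront hd hV
  have hR := hσ.isPressure_pRear hd hV
  have e1 : hp = hFun d (pFront d σ V) up := hs.front
  have e2 : hm = hFun d (pRear d σ V) um := hs.rear
  have e3 : hp' = hFun d (pFront d σ V) up' := hs'.front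
  have e4 : hm' = hFun d (pRear d σ V) um' := hs'.rear
  have t1 := hs.total
  have t2 := hs'.total
  have q1 := (hF.qFun_eq_qFun hR hd hs.up_nonneg hs.um_nonneg).2 hs.slopes
  have q2 := (hF.qFun_eq_qFun hR hd hs'.up_nonneg hs'.um_nonneg).2 hs'.slopes
  rcases lt_trichotomy (qFun d (pFront d σ V) up) (qFun d (pFront d σ V) up') with hq | hq | hq
  · have h1 := hF.hFun_lt_hFun hd hs.up_nonneg hs'.up_nonneg hq
    rw [q1, q2] at hq
    have h2 := hR.hFun_lt_hFun hd hs.um_nonneg hs'.um_nonneg hq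
    linarith
  · have h1 := hF.hFun_congr hd hs.up_nonneg hs'.up_nonneg hq
    exact ⟨by linarith, by linarith⟩
  · have h1 := hF.hFun_lt_hFun hd hs'.up_nonneg hs.up_nonneg hq
    rw [q1, q2] at hq
    have h2 := hR.hFun_lt_hFun hd hs'.um_nonneg hs.um_nonneg hq
    linarith

/-- The common `q` is at least `q_-(0) > q_+(0)`, so the front has positive height. Equality with
`q_-(0)` would make the total length `h_*`. -/
theorem SplitSystem.heights_pos (hσ : ClassA d σ) (hd : 3 ≤ d) (hV : 0 < V)
    {us h hp hm up um : ℝ} (hus : 0 ≤ us)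
    (hslope : convEnvDeriv (pFront d σ V) us = convEnvDeriv (pRear d σ V) 0)
    (hh : hFun d (pFront d σ V) us < h) (hs : SplitSystem d σ V h hp hm up um) :
    0 < hp ∧ 0 < hm := by
  have hF := hσ.isPressure_pFront hd hV
  have hR := hσ.isPressure_pRear hd hV
  have e1 : hp = hFun d (pFront d σ V) up := hs.front
  have e2 : hm = hFun d (pRear d σ V) um := hs.rear
  have q0 := (hF.qFun_lt_qFun hR hd le_rfl le_rfl).2 (hσ.convEnvDeriv_zero_lt hd hV)
  have q1 := (hF.qFun_eq_qFun hR hd hs.up_nonneg hs.um_nonneg).2 hs.slopes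
  have q2 := (hF.qFun_eq_qFun hR hd hus le_rfl).2 hslope
  have q3 := hR.monotoneOn_qFun hd (mem_Ici.2 le_rfl) hs.um_nonneg hs.um_nonneg
  refine ⟨?_, ?_⟩
  · rw [e1, hF.hFun_pos_iff hd hs.up_nonneg, q1]
    exact q0.trans_le q3
  · rw [e2, hR.hFun_pos_iff hd hs.um_nonneg]
    refine lt_of_le_of_ne q3 fun heq => ?_
    have h1 := hF.hFun_congr hd hs.up_nonneg hus (by rw [q1, q2, heq])
    have h2 := hR.hFun_congr hd le_rfl hs.um_nonneg heq
    rw [IsPressure.hFun_zero] at h2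
    linarith [hs.total]

/-- Solutions of the first kind. -/
theorem solution_first_kind (hσ : ClassA d σ) (hd : 3 ≤ d) (hV : 0 < V) {up : ℝ} (hup : 0 ≤ up)
    (hslope : convEnvDeriv (pFront d σ V) up ≤ convEnvDeriv (pRear d σ V) 0) :
    (∃ fp fm : ℝ → ℝ, IsUniqueOptimal d σ V (hFun d (pFront d σ V) up) fp fm ∧
      IsProfile (hFun d (pFront d σ V) up) fp ∧ IsProfile 0 fm ∧
      IsNewtonProfile d (pFront d σ V) up fp ∧ EqOn fm 0 (Icc 0 1) ∧
      IsNewtonBody d (pFront d σ V) up (body d fp fm)) ∧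
    IsLeast (resistanceValues d σ V (hFun d (pFront d σ V) up))
      (convEnv (pFront d σ V) up +
        QFun d (pFront d σ V) up / qFun d (pFront d σ V) up ^ (d - 1) +
        convEnv (pRear d σ V) 0) := by
  have hF := hσ.isPressure_pFront hd hV
  have hR := hσ.isPressure_pRear hd hV
  -- The slope hypothesis says that the front multiplier is at least `B_-`, so the flat rear part
  -- minimizes with the same multiplier.
  have hopt := isUniqueOptimal_of_minimizesSlopes hσ hd hV
    (neg_pos.2 (hF.convEnvDeriv_neg hup)) (hF.isProfile_newtonProfile hd hup)
    IsPressure.isProfile_zero (hF.newtonProfile_one hd hup) rfl (hF.newtonProfile_ac hd hup)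
    IsPressure.ac_zero (hF.minimizesSlopes_newtonProfile hd hup)
    (hR.minimizesSlopes_zero hd (neg_le_neg hslope))
  rw [add_zero] at hopt
  refine ⟨⟨_, _, hopt, hF.isProfile_newtonProfile hd hup, IsPressure.isProfile_zero,
    hF.isNewtonProfile_newtonProfile hd hup, fun _ _ => rfl, _,
    hF.isNewtonProfile_newtonProfile hd hup, rfl⟩, ?_⟩
  have h := hopt.isLeast
  rwa [resistance, hF.partResistance_newtonProfile hd hup, hR.partResistance_zero hd] at h

/-- Solutions of the second kind. -/
theorem solution_second_kind (hσ : ClassA d σ) (hd : 3 ≤ d) (hV : 0 < V) {h hp hm up um : ℝ}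
    (hs : SplitSystem d σ V h hp hm up um) :
    (∃ fp fm : ℝ → ℝ, IsUniqueOptimal d σ V h fp fm ∧ IsProfile hp fp ∧ IsProfile hm fm ∧
      IsNewtonProfile d (pFront d σ V) up fp ∧ IsNewtonProfile d (pRear d σ V) um fm ∧
      ∃ Kp Km : Set (EuclideanSpace ℝ (Fin d)),
        IsNewtonBody d (pFront d σ V) up Kp ∧ IsNewtonBody d (pRear d σ V) um Km ∧
        body d fp fm = Kp ∪ axisFlip d '' Km) ∧
    IsLeast (resistanceValues d σ V h)
      (convEnv (pFront d σ V) up +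
        QFun d (pFront d σ V) up / qFun d (pFront d σ V) up ^ (d - 1) +
        (convEnv (pRear d σ V) um +
          QFun d (pRear d σ V) um / qFun d (pRear d σ V) um ^ (d - 1))) := by
  have hF := hσ.isPressure_pFront hd hV
  have hR := hσ.isPressure_pRear hd hV
  have hup := hs.up_nonneg
  have hum := hs.um_nonneg
  have e1 : hp = hFun d (pFront d σ V) up := hs.front
  have e2 : hm = hFun d (pRear d σ V) um := hs.rear
  have hfp := hF.isProfile_newtonProfile hd hup
  have hfm := hR.isProfile_newtonProfile hd hum
  have hminm := hR.minimizesSlopes_newtonProfile hd hum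
  -- Equality of slopes is equality of the two multipliers.
  rw [← hs.slopes] at hminm
  rw [← e1] at hfp
  rw [← e2] at hfm
  have hopt := isUniqueOptimal_of_minimizesSlopes hσ hd hV
    (neg_pos.2 (hF.convEnvDeriv_neg hup)) hfp hfm
    (hF.newtonProfile_one hd hup) (hR.newtonProfile_one hd hum) (hF.newtonProfile_ac hd hup)
    (hR.newtonProfile_ac hd hum) (hF.minimizesSlopes_newtonProfile hd hup) hminm
  rw [hs.total] at hopt
  have hNp := hF.isNewtonProfile_newtonProfile hd hup
  have hNm := hR.isNewtonProfile_newtonProfile hd hum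
  refine ⟨⟨_, _, hopt, hfp, hfm, hNp, hNm, _, _, ⟨_, hNp, rfl⟩, ⟨_, hNm, rfl⟩,
    body_eq_union hfp.nonpos hfm.nonpos⟩, ?_⟩
  have h := hopt.isLeast
  rwa [resistance, hF.partResistance_newtonProfile hd hup,
    hR.partResistance_newtonProfile hd hum] at h

end ThermalDrag

theorem mainTheorem2 (d : ℕ) [NeZero d] (hd : 3 ≤ d) (σ : ℝ → ℝ) (hσ : ClassA d σ)
    (V : ℝ) (hV : 0 < V) :
    -- the critical length, which does not depend on the choice of `u_*`
    ∃ hstar : ℝ, 0 < hstar ∧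
      (∃ ustar : ℝ, 0 ≤ ustar ∧
        convEnvDeriv (pFront d σ V) ustar = -BConst (pRear d σ V)) ∧
      (∀ ustar : ℝ, 0 ≤ ustar →
        convEnvDeriv (pFront d σ V) ustar = -BConst (pRear d σ V) →
        hstar = hFun d (pFront d σ V) ustar ∧
        hstar = ustar -
          BConst (pRear d σ V) ^ (1 / ((d : ℝ) - 2)) * QFun d (pFront d σ V) ustar) ∧
      ∀ h : ℝ, 0 ≤ h →
        -- solutions of the first kind
        (h ≤ hstar →
          (∃ up : ℝ, 0 ≤ up ∧ hFun d (pFront d σ V) up = h) ∧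
          ∀ up : ℝ, 0 ≤ up → hFun d (pFront d σ V) up = h →
            (∃ fp fm : ℝ → ℝ, IsUniqueOptimal d σ V h fp fm ∧
              IsProfile h fp ∧ IsProfile 0 fm ∧
              IsNewtonProfile d (pFront d σ V) up fp ∧ EqOn fm 0 (Set.Icc 0 1) ∧
              IsNewtonBody d (pFront d σ V) up (body d fp fm)) ∧
            IsLeast (resistanceValues d σ V h)
              (convEnv (pFront d σ V) up +
                QFun d (pFront d σ V) up / qFun d (pFront d σ V) up ^ (d - 1) +
                convEnv (pRear d σ V) 0)) ∧
        -- solutions of the second kind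
        (hstar < h →
          (∃! s : ℝ × ℝ, ∃ up um : ℝ, SplitSystem d σ V h s.1 s.2 up um) ∧
          ∀ hp hm up um : ℝ, SplitSystem d σ V h hp hm up um →
            0 < hp ∧ 0 < hm ∧
            (∃ fp fm : ℝ → ℝ, IsUniqueOptimal d σ V h fp fm ∧
              IsProfile hp fp ∧ IsProfile hm fm ∧
              IsNewtonProfile d (pFront d σ V) up fp ∧
              IsNewtonProfile d (pRear d σ V) um fm ∧
              ∃ Kp Km : Set (EuclideanSpace ℝ (Fin d)),
                IsNewtonBody d (pFront d σ V) up Kp ∧ IsNewtonBody d (pRear d σ V) um Km ∧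
                body d fp fm = Kp ∪ axisFlip d '' Km) ∧
            IsLeast (resistanceValues d σ V h)
              (convEnv (pFront d σ V) up +
                QFun d (pFront d σ V) up / qFun d (pFront d σ V) up ^ (d - 1) +
                (convEnv (pRear d σ V) um +
                  QFun d (pRear d σ V) um / qFun d (pRear d σ V) um ^ (d - 1)))) := by
  have hF := hσ.isPressure_pFront hd hV
  have hR := hσ.isPressure_pRear hd hV
  have hlt := hσ.convEnvDeriv_zero_lt hd hV
  have hR0 := hR.convEnvDeriv_neg (le_refl (0 : ℝ))
  have hB : -BConst (pRear d σ V) = convEnvDeriv (pRear d σ V) 0 := by rw [BConst, neg_neg]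
  rw [hB]
  obtain ⟨us, hus, hslope⟩ := hF.exists_convEnvDeriv_eq (μ := BConst (pRear d σ V))
    (neg_pos.2 hR0) (by rw [hB]; exact hlt.le)
  rw [hB] at hslope
  refine ⟨hFun d (pFront d σ V) us, ?_, ⟨us, hus, hslope⟩, fun u hu hus' => ?_, fun h hh => ⟨?_, ?_⟩⟩
  · rw [hF.hFun_pos_iff hd hus, hF.qFun_lt_qFun hF hd le_rfl hus, hslope]
    exact hlt
  · have heq := hF.hFun_congr hd hus hu
      ((hF.qFun_eq_qFun hF hd hus hu).2 (hslope.trans hus'.symm))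
    refine ⟨heq, heq.trans ?_⟩
    -- At `u_*` the slope is `-B_-`, so `1 / q_+(u_*) = B_- ^ (1 / (d - 2))`.
    rw [hFun, hF.qFun_eq hu, hus', BConst, Real.rpow_neg (neg_pos.2 hR0).le, div_inv_eq_mul,
      mul_comm]
  · intro hle
    refine ⟨?_, ?_⟩
    · have hsub := intermediate_value_Icc hus
        (hF.continuousOn_hFun.mono (fun _ hx => hx.1) : ContinuousOn (hFun d (pFront d σ V)) _)
      rw [IsPressure.hFun_zero] at hsub
      obtain ⟨u, hu, hu'⟩ := hsub ⟨hh, hle⟩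
      exact ⟨u, hu.1, hu'⟩
    · rintro up hup rfl
      refine solution_first_kind hσ hd hV hup ?_
      -- The height and the slope are both ordered as `q` is, so `h ≤ h_*` gives the slope condition
      -- for a flat rear part.
      rw [← hslope, ← hF.qFun_le_qFun hF hd hup hus, ← not_lt, ← hF.hFun_lt_hFun_iff hd hus hup]
      exact not_lt.2 hle
  · intro hlt'
    refine ⟨?_, fun hp hm up um hs => ?_⟩
    · obtain ⟨hp, hm, up, um, hs⟩ := exists_splitSystem hσ hd hV hus hslope hlt'
      refine ⟨(hp, hm), ⟨up, um, hs⟩, ?_⟩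
      rintro ⟨hp', hm'⟩ ⟨up', um', hs'⟩
      obtain ⟨h1, h2⟩ := SplitSystem.heights_unique hσ hd hV hs' hs
      exact Prod.ext h1 h2
    · obtain ⟨h1, h2⟩ := SplitSystem.heights_pos hσ hd hV hus hslope hlt' hs
      exact ⟨h1, h2, solution_second_kind hσ hd hV hs⟩
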